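/- **Setting.** There are $K\ge 1$ arms and a known switching cost $\lambda\ge 0$. An oblivious environment produces loss vectors $\ell_1,\ell_2,\ldots\in[0,1]^K$ (deterministic or random, not depending on the learner's randomization). In round $t$ the learner plays an arm $J_t$; by convention $J_0$ is not an arm, so there is always a switch in round $1$. The pseudo-regret with switching costs is $$R(T,\lambda)=\mathbb E\Big[\sum_{t=1}^T \ell_{t,J_t}\Big]-\min_i\mathbb E\Big[\sum_{t=1}^T \ell_{t,i}\Big]+\lambda\sum_{t=1}^T\Pr(J_{t-1}\ne J_t).$$ **Algorithm (Tsallis-Switch).** Input: learning rates $\eta_n>0$ and block lengths $|B_n|\ge 1$; the rounds $1,2,\ldots$ are divided into consecutive blocks $B_1,B_2,\ldots$ of these lengths. Start with $\tilde C_0=0\in\mathbb R^K$. For $n=1,2,\ldots$ let $$p_n=\operatorname*{arg\,min}_{p}\Big\{\langle p,\tilde C_{n-1}\rangle-\sum_{i=1}^K\frac{4\sqrt{p_i}-2p_i}{\eta_n}\Big\},$$ where $p$ ranges over the probability vectors in $\mathbb R^K$; draw $I_n\sim p_n$ (given the past), play $J_t=I_n$ for all $t\in B_n$, observe $c_{n,I_n}=\sum_{t\in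 B_n}\ell_{t,I_n}$, and put $\tilde C_n(i)=\tilde C_{n-1}(i)+\frac{c_{n,i}}{p_{n,i}}\mathbf 1[I_n=i]$ for all $i$. (For a horizon $T$, the block containing $T$ is cut off at $T$.) **Theorem.** Let $a_n=\frac{3\lambda}{2}\sqrt{n/K}$, and run Tsallis-Switch with $|B_n|=\max\{\lceil a_n\rceil,1\}$ and $\eta_n=\frac{2}{a_n+1}\sqrt{\frac 2n}$. Then in any oblivious environment, for every $T\ge 1$, $$R(T,\lambda)\le 5.25(\lambda K)^{1/3}T^{2/3}+6.4\sqrt{KT}+3\sqrt{2K}+5.25\lambda+6.25.$$ Suppose moreover that the environment is stochastically constrained adversarial, i.e. the loss vectors are drawn one after the other from distributions with fixed gaps: there are constants $\Delta_{i,j}$ such that $\mathbb E[\ell_{t,i}-\ell_{t,j}\mid \ell_1,\ldots,\ell_{t-1}]=\Delta_{i,j}$ almost surely for all $t\ge1$ and all $i,j$ (for losses that are independent across rounds: $\mathbb E[\ell_{t,i}-\ell_{t,j}]=\Delta_{i,j}$). Let $\Delta_i=\Delta_{i,1}-\min_j\Delta_{j,1}$, and suppose that there is a unique best arm $i^*$,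 i.e. $\Delta_{i^*}=0$ and $\Delta_i>0$ for $i\neq i^*$. Then additionally, for every $T\ge 1$, $$\begin{aligned}R(T,\lambda)\le{}&\big(66(\lambda K)^{2/3}T^{1/3}+32\ln T\big)\sum_{i\ne i^*}\frac1{\Delta_i}\\&+\big(160\lambda^{2/3}T^{1/3}K^{1/6}+160\lambda+49\lambda^2+32\big)\sum_{i\ne i^*}\frac1{\Delta_i}+\frac{544\lambda}{\sqrt K}+\lambda+66.\end{aligned}$$ -/

import Mathlib

open MeasureTheory ProbabilityTheory

noncomputable section

namespace TsallisSwitch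

/-! ### Blocks of rounds -/

/-- Last round of the `n`-th block (blocks and rounds are numbered from `1`). -/
def blockEnd (len : ℕ → ℕ) (n : ℕ) : ℕ := ∑ m ∈ Finset.Icc 1 n, len m

/-- The rounds of the `n`-th block, `n ≥ 1`. -/
def block (len : ℕ → ℕ) (n : ℕ) : Finset ℕ :=
  Finset.Ioc (blockEnd len (n - 1)) (blockEnd len n)

/-- The index of the block that contains round `t ≥ 1`: the least `n` such that the first `n`
blocks have total length at least `t`. -/
def blockIndex (len : ℕ → ℕ) (t : ℕ) : ℕ := sInf {n | t ≤ blockEnd len n}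

/-- When all lengths are positive, `blockIndex len t = n` says that `t` is in the `n`-th block. -/
theorem blockIndex_eq_iff (len : ℕ → ℕ) (hlen : ∀ n, 1 ≤ len n) {t n : ℕ}
    (hn : 1 ≤ n) : blockIndex len t = n ↔ t ∈ block len n := by
  have hmono : Monotone (blockEnd len) := fun a b hab =>
    Finset.sum_le_sum_of_subset (Finset.Icc_subset_Icc_right hab)
  have hge : ∀ n, n ≤ blockEnd len n := fun n => by
    have h := Finset.card_nsmul_le_sum (Finset.Icc 1 n) len 1 (fun m _ => hlen m)
    simpa [blockEnd] using h
  have hne : {n | t ≤ blockEnd len n}.Nonempty := ⟨t, hge t⟩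
  constructor
  · rintro rfl
    have h1 : t ≤ blockEnd len (blockIndex len t) := Nat.sInf_mem hne
    refine Finset.mem_Ioc.2 ⟨?_, h1⟩
    by_contra h
    have h2 : blockIndex len t ≤ blockIndex len t - 1 := Nat.sInf_le (not_lt.1 h)
    omega
  · intro h
    obtain ⟨h1, h2⟩ := Finset.mem_Ioc.1 h
    refine le_antisymm (Nat.sInf_le h2) ?_
    by_contra hlt
    have h3 : t ≤ blockEnd len (blockIndex len t) := Nat.sInf_mem hne
    have h4 : blockEnd len (blockIndex len t) ≤ blockEnd len (n - 1) := hmono (by omega)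
    omega

/-! ### The algorithm -/

variable {K : ℕ}

/-- The regularized objective `⟨p, C⟩ - ∑ i, (4 √(p i) - 2 p i) / η`. -/
def objective (η : ℝ) (C p : Fin K → ℝ) : ℝ :=
  ∑ i, p i * C i - ∑ i, (4 * √(p i) - 2 * p i) / η

/-- `p` minimizes the regularized objective over the probability simplex. -/
def IsTsallisArgmin (η : ℝ) (C p : Fin K → ℝ) : Prop :=
  p ∈ stdSimplex ℝ (Fin K) ∧ IsMinOn (objective η C) (stdSimplex ℝ (Fin K)) p

/-- The minimizer of the regularized objective over the probability simplex. -/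
def tsallisArgmin (η : ℝ) (C : Fin K → ℝ) : Fin K → ℝ :=
  Classical.epsilon (IsTsallisArgmin η C)

/-- The minimizer exists. -/
theorem isTsallisArgmin_tsallisArgmin [NeZero K] (η : ℝ) (C : Fin K → ℝ) :
    IsTsallisArgmin η C (tsallisArgmin η C) := by
  refine Classical.epsilon_spec (p := IsTsallisArgmin η C) ?_
  have hne : (stdSimplex ℝ (Fin K)).Nonempty := ⟨_, single_mem_stdSimplex ℝ (0 : Fin K)⟩
  have hc : Continuous (objective η C) := by
    unfold objective
    fun_prop
  exact (isCompact_stdSimplex ℝ (Fin K)).exists_isMinOn hne hc.continuousOn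

/-- The minimizer is unique. -/
theorem IsTsallisArgmin.unique {η : ℝ} (hη : 0 < η) {C p q : Fin K → ℝ}
    (hp : IsTsallisArgmin η C p) (hq : IsTsallisArgmin η C q) : p = q := by
  by_contra hne
  obtain ⟨j, hj⟩ := Function.ne_iff.1 hne
  have hm : (fun i => (1 / 2 : ℝ) * p i + (1 / 2 : ℝ) * q i) ∈ stdSimplex ℝ (Fin K) := by
    have := convex_stdSimplex ℝ (Fin K) hp.1 hq.1 (by norm_num : (0 : ℝ) ≤ 1 / 2)
      (by norm_num : (0 : ℝ) ≤ 1 / 2) (by norm_num)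
    exact this
  have h1 := hp.2 hm
  have h2 := hq.2 hm
  simp only [Set.mem_ofPred_eq, objective, ← Finset.sum_sub_distrib] at h1 h2
  have key : ∑ i, (((1 / 2 : ℝ) * p i + (1 / 2 : ℝ) * q i) * C i
        - (4 * √((1 / 2 : ℝ) * p i + (1 / 2 : ℝ) * q i)
          - 2 * ((1 / 2 : ℝ) * p i + (1 / 2 : ℝ) * q i)) / η)
      < ∑ i, ((1 / 2 : ℝ) * (p i * C i - (4 * √(p i) - 2 * p i) / η)
        + (1 / 2 : ℝ) * (q i * C i - (4 * √(q i) - 2 * q i) / η)) := by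
    refine Finset.sum_lt_sum (fun i _ => ?_) ⟨j, Finset.mem_univ j, ?_⟩
    · have hs := Real.strictConcaveOn_sqrt.concaveOn.2 (hp.1.1 i) (hq.1.1 i)
        (by norm_num : (0 : ℝ) ≤ 1 / 2) (by norm_num : (0 : ℝ) ≤ 1 / 2) (by norm_num)
      simp only [smul_eq_mul] at hs
      have := div_le_div_of_nonneg_right hs hη.le
      ring_nf at this ⊢
      linarith
    · have hs := Real.strictConcaveOn_sqrt.2 (hp.1.1 j) (hq.1.1 j) hj
        (by norm_num : (0 : ℝ) < 1 / 2) (by norm_num : (0 : ℝ) < 1 / 2) (by norm_num)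
      simp only [smul_eq_mul] at hs
      have := div_lt_div_of_pos_right hs hη
      ring_nf at this ⊢
      linarith
  rw [Finset.sum_add_distrib, ← Finset.mul_sum, ← Finset.mul_sum] at key
  linarith

/-- The cumulative loss of arm `i` over the `n`-th block. -/
def blockLoss (len : ℕ → ℕ) (ℓ : ℕ → Fin K → ℝ) (n : ℕ) (i : Fin K) : ℝ :=
  ∑ t ∈ block len n, ℓ t i

/-- The cumulative importance-weighted loss estimates after `n` blocks, when the loss vectors are
`ℓ 1, ℓ 2, …` and the arms drawn for the blocks are `I 1, I 2, …`. -/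
def cumEstimate (η : ℕ → ℝ) (len : ℕ → ℕ) (ℓ : ℕ → Fin K → ℝ) (I : ℕ → Fin K) :
    ℕ → Fin K → ℝ
  | 0 => 0
  | n + 1 => fun i => cumEstimate η len ℓ I n i +
      if I (n + 1) = i then
        blockLoss len ℓ (n + 1) i / tsallisArgmin (η (n + 1)) (cumEstimate η len ℓ I n) i
      else 0

/-- The distribution from which the arm of the `n`-th block is drawn, `n ≥ 1`. -/
def samplingDist (η : ℕ → ℝ) (len : ℕ → ℕ) (ℓ : ℕ → Fin K → ℝ) (I : ℕ → Fin K) (n : ℕ) :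
    Fin K → ℝ :=
  tsallisArgmin (η n) (cumEstimate η len ℓ I (n - 1))

/-! ### Environment and learner -/

variable {Ω : Type*}

/-- A (possibly random) sequence of loss vectors `ℓ 1, ℓ 2, …` in `[0, 1]^K`. -/
structure IsLossProcess [MeasurableSpace Ω] (ℓ : ℕ → Ω → Fin K → ℝ) : Prop where
  measurable : ∀ t, 1 ≤ t → Measurable (ℓ t)
  mem_Icc : ∀ t, 1 ≤ t → ∀ ω i, ℓ t ω i ∈ Set.Icc (0 : ℝ) 1

/-- The σ-algebra generated by the whole loss sequence `ℓ 1, ℓ 2, …` and by the arms drawn for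
the blocks `1, …, n - 1`. -/
abbrev drawInfo (ℓ : ℕ → Ω → Fin K → ℝ) (I : ℕ → Ω → Fin K) (n : ℕ) : MeasurableSpace Ω :=
  (⨆ t, ⨆ _ : 1 ≤ t, MeasurableSpace.comap (ℓ t) inferInstance) ⊔
    ⨆ m, ⨆ _ : m ∈ Finset.Ico 1 n, MeasurableSpace.comap (I m) ⊤

/-- `I 1, I 2, …` are the arms drawn by Tsallis-Switch with learning rates `η` and block lengths
`len` against the loss sequence `ℓ`: given the past draws, `I n` has law `samplingDist … n`.
Conditioning also on the whole loss sequence says that the environment is oblivious: the losses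
carry no information about the fresh randomization of the learner. -/
structure IsTsallisSwitchRun [MeasurableSpace Ω] (μ : Measure Ω) (η : ℕ → ℝ) (len : ℕ → ℕ)
    (ℓ : ℕ → Ω → Fin K → ℝ) (I : ℕ → Ω → Fin K) : Prop where
  measurable : ∀ n, 1 ≤ n → Measurable (I n)
  condProb_eq : ∀ n, 1 ≤ n → ∀ i,
    μ⟦{ω | I n ω = i} | drawInfo ℓ I n⟧ =ᵐ[μ]
      fun ω => samplingDist η len (fun t => ℓ t ω) (fun m => I m ω) n i

/-- The arm played at round `t`: the arm of the block of `t`. At the fictitious round `0` no arm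
is played, so that there is always a switch at round `1`. -/
def playedArm (len : ℕ → ℕ) (I : ℕ → Ω → Fin K) (t : ℕ) (ω : Ω) : Option (Fin K) :=
  if t = 0 then none else some (I (blockIndex len t) ω)

/-- The pseudo-regret with switching cost `lam` after `T` rounds of the action process `J`. -/
def pseudoRegret [MeasurableSpace Ω] (μ : Measure Ω) (ℓ : ℕ → Ω → Fin K → ℝ)
    (J : ℕ → Ω → Option (Fin K)) (lam : ℝ) (T : ℕ) : ℝ :=
  (∫ ω, ∑ t ∈ Finset.Icc 1 T, (J t ω).elim 0 (ℓ t ω) ∂μ)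
    - (⨅ i, ∫ ω, ∑ t ∈ Finset.Icc 1 T, ℓ t ω i ∂μ)
    + lam * ∑ t ∈ Finset.Icc 1 T, μ.real {ω | J (t - 1) ω ≠ J t ω}

/-! ### The stochastically constrained adversarial regime -/

/-- The σ-algebra generated by the loss vectors of the rounds `1, …, t - 1`. -/
abbrev pastLosses (ℓ : ℕ → Ω → Fin K → ℝ) (t : ℕ) : MeasurableSpace Ω :=
  ⨆ s, ⨆ _ : s ∈ Finset.Ico 1 t, MeasurableSpace.comap (ℓ s) inferInstance

/-- Stochastically constrained adversarial regime: the loss vectors are drawn one after the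
other, and the expected gap between any two arms in a draw does not vary. The distribution of a
draw may depend on the round and on the past losses; when the loss vectors of different rounds are
independent, the condition says that `𝔼[ℓ t i - ℓ t j] = Δ i j` for all `t`. -/
def IsStochasticallyConstrained [MeasurableSpace Ω] (μ : Measure Ω) (ℓ : ℕ → Ω → Fin K → ℝ)
    (Δ : Fin K → Fin K → ℝ) : Prop :=
  ∀ t, 1 ≤ t → ∀ i j,
    μ[fun ω => ℓ t ω i - ℓ t ω j | pastLosses ℓ t] =ᵐ[μ] fun _ => Δ i j

/-- The suboptimality gap of arm `i`, with the first arm as the reference. -/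
def subGap [NeZero K] (Δ : Fin K → Fin K → ℝ) (i : Fin K) : ℝ := Δ i 0 - ⨅ j, Δ j 0

/-- `istar` is the unique best arm. -/
def IsUniqueBestArm [NeZero K] (Δ : Fin K → Fin K → ℝ) (istar : Fin K) : Prop :=
  subGap Δ istar = 0 ∧ ∀ i, i ≠ istar → 0 < subGap Δ i

/-! ### Parameters tuned to a known switching cost -/

/-- `a n = (3 λ / 2) √(n / K)`. -/
def aParam (lam : ℝ) (K n : ℕ) : ℝ := 3 * lam / 2 * √((n : ℝ) / K)

/-- `|B n| = max {⌈a n⌉, 1}`. -/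
def blockLen (lam : ℝ) (K n : ℕ) : ℕ := max ⌈aParam lam K n⌉₊ 1

/-- `η n = (2 / (a n + 1)) √(2 / n)`. -/
def learningRate (lam : ℝ) (K n : ℕ) : ℝ := 2 / (aParam lam K n + 1) * √(2 / (n : ℝ))

end TsallisSwitch

end

noncomputable section

namespace TsallisSwitch

section

variable {K : ℕ}

/-! ### The minimizer of the regularized objective -/

/-! Each block counts as one round of a bandit game with losses in `[0, len]`, played by
follow-the-regularized-leader (FTRL) with the 1/2-Tsallis entropy. The minimizer is p_i = 4 / (η
(C_i + x))² with a normalizer x, and completing a square gives both its optimality and a bound on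
the change of the optimal value in one step (`stability_le`). Telescoping optimal values bounds the
regret against the loss estimates, path by path, by stability plus penalty terms
(`pathwise_regret_le`). The estimates are unbiased given the whole loss sequence, so the bound
passes to expectations (`expected_regret_le`).

The tuning makes the expected stability and the penalty of block n + 1 both at most √2 r ∑ √p_i,
where r = `blockRate` = a + 1/√(n+1) and a = 3λ/(2√K). Since blocks have length at least a √n, N
complete blocks within T rounds force λ N^(3/2) ≤ √K T (`lam_mul_le_of_blockEnd_le`).

Adversarial bound: ∑ √p_i ≤ √K, there is at most one switch per block, and summing r over the blocks
gives the rate.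

Stochastic bound: let s be the best arm. Shifting the loss estimates by a constant replaces ∑ √p_i
by a multiple of ∑_{i≠s} √p_i, except in the first 99 blocks. Let X be the loss regret against s
over whole blocks, Y its FTRL bound and W the expected number of switches. Then R ≤ X + λW ≤ 2Y - X
+ λW. Fixed gaps make X a sum over blocks of `len` · E ∑ p_i Δ_i, because earlier draws do not bias
the gap of a later round (`integral_samplingDist_mul_gap`). A switch between blocks requires one of
two draws to miss s, so W ≤ 1 + 2 ∑ E ∑_{i≠s} p_i. The right side splits into one quadratic in √p_i
per arm and block; maximizing each and summing over blocks gives the bound. -/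

theorem exists_dual_normalizer [NeZero K] {η : ℝ} (hη : 0 < η) (C : Fin K → ℝ) :
    ∃ x : ℝ, (∀ i, 0 < C i + x) ∧ ∑ i, 4 / (η * (C i + x)) ^ 2 = 1 ∧
      ∃ j, C j + x ≤ 2 * √K / η := by
  -- Intermediate value theorem in y = min C + x. At y = 2√K/η every term is at most 1/K; at y = 2/η
  -- the term of the minimal coordinate is already 1.
  obtain ⟨j, hj⟩ := Finite.exists_min C
  have hK : (1 : ℝ) ≤ K := by exact_mod_cast NeZero.one_le
  have hsK : 1 ≤ √(K : ℝ) := Real.one_le_sqrt.2 hK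
  have hle : 2 / η ≤ 2 * √K / η := by gcongr; linarith
  have hpos : ∀ y ∈ Set.Icc (2 / η) (2 * √K / η), ∀ i, 0 < C i - C j + y := fun y hy i => by
    have h0 : 0 < 2 / η := by positivity
    linarith [hj i, hy.1]
  have hcont : ContinuousOn (fun y => ∑ i, 4 / (η * (C i - C j + y)) ^ 2)
      (Set.Icc (2 / η) (2 * √K / η)) := by
    refine continuousOn_finsetSum _ fun i _ => ContinuousOn.div (by fun_prop) (by fun_prop) ?_
    intro y hy
    have := hpos y hy i
    positivity
  have hhi : ∑ i, 4 / (η * (C i - C j + 2 * √K / η)) ^ 2 ≤ 1 := by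
    calc ∑ i, 4 / (η * (C i - C j + 2 * √K / η)) ^ 2 ≤ ∑ _i : Fin K, 1 / (K : ℝ) := by
          refine Finset.sum_le_sum fun i _ => ?_
          rw [div_le_div_iff₀ (by have := hpos _ ⟨hle, le_rfl⟩ i; positivity) (by positivity)]
          have h1 : 2 * √K ≤ η * (C i - C j + 2 * √K / η) := by
            rw [mul_add, mul_div_cancel₀ _ hη.ne']
            nlinarith [hj i]
          have h2 : (2 * √(K : ℝ)) ^ 2 ≤ (η * (C i - C j + 2 * √K / η)) ^ 2 := by gcongr
          rw [mul_pow, Real.sq_sqrt (by positivity)] at h2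
          linarith
      _ = 1 := by simp
  have hlo : 1 ≤ ∑ i, 4 / (η * (C i - C j + 2 / η)) ^ 2 := by
    have h1 : 4 / (η * (C j - C j + 2 / η)) ^ 2 = 1 := by
      rw [sub_self, zero_add, mul_div_cancel₀ _ hη.ne']; norm_num
    rw [← h1]
    exact Finset.single_le_sum (f := fun i => 4 / (η * (C i - C j + 2 / η)) ^ 2)
      (fun i _ => by positivity) (Finset.mem_univ j)
  obtain ⟨y, hy, hy1⟩ := intermediate_value_Icc' hle hcont ⟨hhi, hlo⟩
  have he : ∀ i, C i + (y - C j) = C i - C j + y := fun i => by ring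
  refine ⟨y - C j, fun i => ?_, ?_, j, ?_⟩
  · rw [he]; exact hpos y hy i
  · simpa only [he] using hy1
  · rw [he]; linarith [hy.2]

theorem objective_of_mem_stdSimplex {η : ℝ} {C p : Fin K → ℝ} (hp : p ∈ stdSimplex ℝ (Fin K)) :
    objective η C p = ∑ i, (p i * C i - 4 / η * √(p i)) + 2 / η := by
  have h : ∑ i, (4 * √(p i) - 2 * p i) / η = ∑ i, 4 / η * √(p i) - 2 / η := by
    rw [← mul_one (2 / η), ← hp.2, Finset.mul_sum, ← Finset.sum_sub_distrib]
    exact Finset.sum_congr rfl fun i _ => by ring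
  rw [objective, h, Finset.sum_sub_distrib]
  ring

/-- The gap is A (√q - 2/(ηA))², with equality at q = 4/(ηA)². This gives optimality of the closed
form, and weak duality in `stability_le`. -/
theorem four_div_mul_sqrt_le {η A q : ℝ} (hη : 0 < η) (hA : 0 < A) (hq : 0 ≤ q) :
    4 / η * √q ≤ q * A + 4 / (η ^ 2 * A) := by
  have hs := Real.sq_sqrt hq
  have h : q * A + 4 / (η ^ 2 * A) - 4 / η * √q = A * (√q - 2 / (η * A)) ^ 2 := by
    rw [← hs, Real.sqrt_sq (Real.sqrt_nonneg q)]
    field_simp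
    ring
  have : 0 ≤ A * (√q - 2 / (η * A)) ^ 2 := by positivity
  linarith

theorem sqrt_four_div_sq {B : ℝ} (hB : 0 < B) : √(4 / B ^ 2) = 2 / B := by
  rw [show (4 : ℝ) / B ^ 2 = (2 / B) ^ 2 by ring, Real.sqrt_sq (by positivity)]

/-- The closed form of the minimizer, up to the normalizing constant `x`. -/
theorem exists_tsallisArgmin_eq [NeZero K] {η : ℝ} (hη : 0 < η) (C : Fin K → ℝ) :
    ∃ x : ℝ, (∀ i, 0 < C i + x) ∧ (∀ i, tsallisArgmin η C i = 4 / (η * (C i + x)) ^ 2) ∧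
      ∃ j, C j + x ≤ 2 * √K / η := by
  obtain ⟨x, hx, hsum, hj⟩ := exists_dual_normalizer hη C
  refine ⟨x, hx, ?_, hj⟩
  set p : Fin K → ℝ := fun i => 4 / (η * (C i + x)) ^ 2 with hp
  have hpS : p ∈ stdSimplex ℝ (Fin K) := ⟨fun i => by positivity, hsum⟩
  suffices IsTsallisArgmin η C p from
    fun i => congrFun ((isTsallisArgmin_tsallisArgmin η C).unique hη this) i
  refine ⟨hpS, fun q hq => ?_⟩
  show objective η C p ≤ objective η C q
  rw [objective_of_mem_stdSimplex hpS, objective_of_mem_stdSimplex hq]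
  have h1 : ∑ i, (p i * C i - 4 / η * √(p i)) = ∑ i, (-(p i * x) - 4 / (η ^ 2 * (C i + x))) := by
    refine Finset.sum_congr rfl fun i _ => ?_
    have hA := hx i
    simp only [hp]
    rw [sqrt_four_div_sq (by positivity)]
    field_simp
    ring
  have h2 : ∑ i, (-(q i * x) - 4 / (η ^ 2 * (C i + x))) ≤ ∑ i, (q i * C i - 4 / η * √(q i)) :=
    Finset.sum_le_sum fun i _ => by
      have := four_div_mul_sqrt_le hη (hx i) (hq.1 i)
      linarith
  rw [h1]
  simp only [Finset.sum_sub_distrib, Finset.sum_neg_distrib, ← Finset.sum_mul, hpS.2, hq.2] at h2 ⊢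
  linarith

/-! ### Positivity, lower bounds and continuity of the minimizer. -/

theorem tsallisArgmin_mem [NeZero K] (η : ℝ) (C : Fin K → ℝ) :
    tsallisArgmin η C ∈ stdSimplex ℝ (Fin K) := (isTsallisArgmin_tsallisArgmin η C).1

theorem tsallisArgmin_pos [NeZero K] {η : ℝ} (hη : 0 < η) (C : Fin K → ℝ) (i : Fin K) :
    0 < tsallisArgmin η C i := by
  obtain ⟨x, hx, hp, -⟩ := exists_tsallisArgmin_eq hη C
  have := hx i
  rw [hp]
  positivity

/-- Bounded estimates keep all probabilities away from 0, so the next importance-weighted estimate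
is bounded again. All integrability below rests on this. -/
theorem le_tsallisArgmin [NeZero K] {η M : ℝ} (hη : 0 < η) {C : Fin K → ℝ}
    (hC : ∀ i, 0 ≤ C i ∧ C i ≤ M) (i : Fin K) :
    4 / (η * (M + 2 * √K / η)) ^ 2 ≤ tsallisArgmin η C i := by
  obtain ⟨x, hx, hp, j, hj⟩ := exists_tsallisArgmin_eq hη C
  have := hx i
  rw [hp]
  have h1 : C i + x ≤ M + 2 * √K / η := by linarith [(hC i).2, (hC j).1]
  gcongr

/-- The set of pairs (C, minimizer) is closed and the simplex is compact, so projecting to C is a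
closed map; uniqueness identifies the fibre. The purpose is measurability of the sampling
distributions. -/
theorem continuous_tsallisArgmin [NeZero K] {η : ℝ} (hη : 0 < η) :
    Continuous (tsallisArgmin η : (Fin K → ℝ) → Fin K → ℝ) := by
  let f : (Fin K → ℝ) → stdSimplex ℝ (Fin K) := fun C => ⟨tsallisArgmin η C, tsallisArgmin_mem η C⟩
  suffices Continuous f from continuous_subtype_val.comp this
  have hobj : Continuous fun x : (Fin K → ℝ) × (Fin K → ℝ) => objective η x.1 x.2 := by
    unfold objective
    fun_prop
  refine continuous_iff_isClosed.2 fun F hF => ?_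
  have hG : IsClosed ((fun x : (Fin K → ℝ) × stdSimplex ℝ (Fin K) => x.2) ⁻¹' F ∩
      ⋂ q ∈ stdSimplex ℝ (Fin K), {x | objective η x.1 x.2 ≤ objective η x.1 q}) := by
    refine (hF.preimage continuous_snd).inter
      (isClosed_iInter fun q => isClosed_iInter fun _ => isClosed_le ?_ ?_)
    · exact hobj.comp (continuous_fst.prodMk (continuous_subtype_val.comp continuous_snd))
    · exact hobj.comp (continuous_fst.prodMk continuous_const)
  convert isClosedMap_fst_of_compactSpace _ hG using 1
  ext C
  simp only [Set.mem_preimage, Set.mem_image, Set.mem_inter_iff, Set.mem_iInter,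
    Set.mem_ofPred_eq, Prod.exists, exists_and_right, exists_eq_right]
  refine ⟨fun h => ⟨f C, h, (isTsallisArgmin_tsallisArgmin η C).2⟩, ?_⟩
  rintro ⟨p, hp, hmin⟩
  have h : p = f C :=
    Subtype.ext (IsTsallisArgmin.unique hη ⟨p.2, hmin⟩ (isTsallisArgmin_tsallisArgmin η C))
  exact h ▸ hp

/-- The optimal value of the regularized objective. -/
def optValue (η : ℝ) (C : Fin K → ℝ) : ℝ := objective η C (tsallisArgmin η C)

theorem optValue_le [NeZero K] (η : ℝ) (C : Fin K → ℝ) {q : Fin K → ℝ}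
    (hq : q ∈ stdSimplex ℝ (Fin K)) : optValue η C ≤ objective η C q :=
  (isTsallisArgmin_tsallisArgmin η C).2 hq

/-- The local-norm bound for one step of the regularized leader. The loss vector `v` may be shifted
by a constant `z`. -/
theorem stability_le [NeZero K] {η : ℝ} (hη : 0 < η) (C v : Fin K → ℝ) (z : ℝ)
    (hz : ∀ i, z - v i < 2 / (η * √(tsallisArgmin η C i))) :
    ∑ i, tsallisArgmin η C i * v i - optValue η (C + v) + optValue η C ≤
      ∑ i, tsallisArgmin η C i * (z - v i) ^ 2 /
        (2 / (η * √(tsallisArgmin η C i)) - (z - v i)) := by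
  obtain ⟨x, hx, hp, -⟩ := exists_tsallisArgmin_eq hη C
  -- The denominators in the statement are the dual variables C_i + x in disguise.
  have hA : ∀ i, 2 / (η * √(tsallisArgmin η C i)) = C i + x := fun i => by
    have := hx i
    rw [hp, sqrt_four_div_sq (by positivity)]
    field_simp
  simp only [hA] at hz ⊢
  set p := tsallisArgmin η C with hpdef
  set q := tsallisArgmin η (C + v) with hqdef
  have hpS : p ∈ stdSimplex ℝ (Fin K) := tsallisArgmin_mem η C
  have hqS : q ∈ stdSimplex ℝ (Fin K) := tsallisArgmin_mem η (C + v)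
  rw [optValue, optValue, ← hpdef, ← hqdef, objective_of_mem_stdSimplex hpS,
    objective_of_mem_stdSimplex hqS]
  have h1 : ∑ i, (p i * C i - 4 / η * √(p i)) = ∑ i, (-(p i * x) - 4 / (η ^ 2 * (C i + x))) := by
    refine Finset.sum_congr rfl fun i _ => ?_
    have hA := hx i
    rw [hp, sqrt_four_div_sq (by positivity)]
    field_simp
    ring
  -- Weak duality at C + v with the dual point x - z: a lower bound on the new optimal value needs
  -- no exact normalizer for C + v.
  have h2 : ∑ i, (q i * (z - x) - 4 / (η ^ 2 * (C i + x - (z - v i)))) ≤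
      ∑ i, (q i * (C + v) i - 4 / η * √(q i)) :=
    Finset.sum_le_sum fun i _ => by
      have := four_div_mul_sqrt_le hη (sub_pos.2 (hz i)) (hqS.1 i)
      simp only [Pi.add_apply]
      linarith
  have h3 : ∑ i, p i * (z - v i) ^ 2 / (C i + x - (z - v i)) =
      ∑ i, (4 / (η ^ 2 * (C i + x - (z - v i))) - 4 / (η ^ 2 * (C i + x)) - p i * (z - v i)) := by
    refine Finset.sum_congr rfl fun i _ => ?_
    have hA := hx i
    have hB := sub_pos.2 (hz i)
    rw [hp]
    field_simp
    ring
  rw [h1, h3]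
  simp only [Finset.sum_sub_distrib, Finset.sum_neg_distrib, ← Finset.sum_mul, hpS.2, hqS.2,
    mul_sub] at h2 ⊢
  linarith

end

section

variable {K : ℕ}

/-! ### Stability of one step -/

/-- The stability term of the step from `C` in which arm `i` is drawn and suffers loss `c`. -/
def stepStability (η : ℝ) (C : Fin K → ℝ) (i : Fin K) (c : ℝ) : ℝ :=
  ∑ k, tsallisArgmin η C k * Pi.single (M := fun _ => ℝ) i (c / tsallisArgmin η C i) k
    - optValue η (C + Pi.single i (c / tsallisArgmin η C i)) + optValue η C

/-- Without a shift (z = 0) only the drawn arm contributes to `stability_le`, and the estimate in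
its denominator may be dropped. -/
theorem stepStability_le [NeZero K] {η : ℝ} (hη : 0 < η) (C : Fin K → ℝ) (i : Fin K) {c b : ℝ}
    (hc : 0 ≤ c) (hcb : c ≤ b) :
    stepStability η C i c ≤ η / 2 * b ^ 2 / √(tsallisArgmin η C i) := by
  have hp := tsallisArgmin_pos hη C
  have hs : ∀ k, 0 < √(tsallisArgmin η C k) := fun k => Real.sqrt_pos.2 (hp k)
  refine (stability_le hη C _ 0 fun k => ?_).trans ?_
  · have h1 : 0 ≤ Pi.single (M := fun _ => ℝ) i (c / tsallisArgmin η C i) k := by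
      rcases eq_or_ne k i with rfl | h
      · simpa using div_nonneg hc (hp k).le
      · simp [h]
    have h2 : 0 < 2 / (η * √(tsallisArgmin η C k)) := by have := hs k; positivity
    linarith
  · rw [Finset.sum_eq_single i (fun k _ hk => by simp [hk]) (by simp)]
    simp only [Pi.single_eq_same, zero_sub, sub_neg_eq_add]
    have hpi := hp i
    have hsi := hs i
    have hsq := Real.sq_sqrt hpi.le
    set s := √(tsallisArgmin η C i)
    rw [← hsq]
    calc s ^ 2 * (-(c / s ^ 2)) ^ 2 / (2 / (η * s) + c / s ^ 2)
        ≤ s ^ 2 * (-(c / s ^ 2)) ^ 2 / (2 / (η * s)) := by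
          gcongr
          have : 0 ≤ c / s ^ 2 := by positivity
          linarith
      _ = η / 2 * c ^ 2 / s := by field_simp
      _ ≤ _ := by gcongr

/-- The shift z = c / p_i cancels the contribution of the drawn arm and moves it to the other arms.
When the drawn arm is likely, this removes its own √p_i from the bound. -/
theorem stepStability_le_of_half_le [NeZero K] {η : ℝ} (hη : 0 < η) (C : Fin K → ℝ) (i : Fin K)
    {c b : ℝ} (hc : 0 ≤ c) (hcb : c ≤ b) (hi : 1 / 2 ≤ tsallisArgmin η C i)
    (hb : 5 * (η * b) ≤ √2) :
    stepStability η C i c ≤ 5 / 4 * (η / 2 * b ^ 2) / tsallisArgmin η C i *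
      ∑ k ∈ Finset.univ.erase i, √(tsallisArgmin η C k) := by
  have hp := tsallisArgmin_pos hη C
  have hS := tsallisArgmin_mem η C
  unfold stepStability
  set p := tsallisArgmin η C with hpdef
  have hs : ∀ k, 0 < √(p k) := fun k => Real.sqrt_pos.2 (hp k)
  have hpi := hp i
  have hk : ∀ k, k ≠ i → p k ≤ 1 / 2 := fun k hk => by
    have h1 : p i + p k ≤ 1 := by
      rw [← hS.2, ← Finset.sum_pair hk.symm]
      exact Finset.sum_le_sum_of_subset_of_nonneg (Finset.subset_univ _) fun j _ _ => (hp j).le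
    linarith
  -- With p_k ≤ 1/2 ≤ p_i and 5ηb ≤ √2 the shift is at most a fifth of the dual variable, so the
  -- denominator keeps 4/5 of it; hence the factor 5/4.
  have hz : ∀ k, k ≠ i → c / p i ≤ 2 / (η * √(p k)) / 5 := fun k hki => by
    have h1 : √2 * √(p k) ≤ 1 := by
      rw [← Real.sqrt_mul (by norm_num)]
      exact Real.sqrt_le_one.2 (by linarith [hk k hki])
    have h2 := hs k
    rw [div_div, div_le_div_iff₀ hpi (by positivity)]
    calc c * (η * √(p k) * 5) = 5 * (η * c) * √(p k) := by ring
      _ ≤ 5 * (η * b) * √(p k) := by gcongr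
      _ ≤ √2 * √(p k) := by gcongr
      _ ≤ 2 * p i := by linarith
  refine (stability_le hη C _ (c / p i) fun k => ?_).trans ?_
  · have h2 : 0 < 2 / (η * √(p k)) := by have := hs k; positivity
    rcases eq_or_ne k i with rfl | h
    · simpa using h2
    · have := hz k h
      simp only [Pi.single_apply, h, if_false, sub_zero]
      linarith
  · rw [← hpdef, ← Finset.add_sum_erase _ _ (Finset.mem_univ i), Finset.mul_sum]
    simp only [Pi.single_eq_same, sub_self]
    rw [zero_pow two_ne_zero, mul_zero, zero_div, zero_add]
    refine Finset.sum_le_sum fun k hki => ?_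
    have hki := Finset.ne_of_mem_erase hki
    simp only [Pi.single_apply, hki, if_false, sub_zero]
    have h1 := hz k hki
    have h2 := hs k
    have hpk := hp k
    calc p k * (c / p i) ^ 2 / (2 / (η * √(p k)) - c / p i)
        ≤ p i * (b / p i) ^ 2 / (4 / 5 * (2 / (η * √(p k)))) := by
          gcongr
          · linarith [hk k hki]
          · linarith
      _ = _ := by field_simp

/-! ### Pathwise regret of the regularized leader -/

/-- The sum telescopes up to changes of the learning rate. The minimizer for the new rate competes
in the problem with the old rate, and the two objectives differ there by the increment of ρ = 1/η
times the entropy. The convention ρ 0 = 0 treats the first step alike. -/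
theorem sum_optValue_sub_le [NeZero K] {η ρ : ℕ → ℝ} (h0 : ρ 0 = 0)
    (hρ : ∀ n, ρ (n + 1) = (η (n + 1))⁻¹) (C : ℕ → Fin K → ℝ) (hC : C 0 = 0) (N : ℕ) :
    ∑ n ∈ Finset.range (N + 1), (optValue (η (n + 1)) (C (n + 1)) - optValue (η (n + 1)) (C n)) ≤
      optValue (η (N + 1)) (C (N + 1)) + ∑ n ∈ Finset.range (N + 1), (ρ (n + 1) - ρ n) *
        (4 * ∑ i, √(tsallisArgmin (η (n + 1)) (C n) i) - 2) := by
  have hobj : ∀ (n : ℕ) (D q : Fin K → ℝ), q ∈ stdSimplex ℝ (Fin K) →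
      objective (η (n + 1)) D q = ∑ i, q i * D i - ρ (n + 1) * (4 * ∑ i, √(q i) - 2) := by
    intro n D q hq
    rw [objective_of_mem_stdSimplex hq, hρ, Finset.sum_sub_distrib, ← Finset.mul_sum]
    ring
  induction N with
  | zero =>
    have h := hobj 0 (C 0) _ (tsallisArgmin_mem (η 1) (C 0))
    simp only [hC, Pi.zero_apply, mul_zero, Finset.sum_const_zero, zero_sub] at h
    simp only [zero_add, Finset.range_one, Finset.sum_singleton, hC, h0, sub_zero] at h ⊢
    rw [optValue, optValue, h]
    linarith
  | succ N ih =>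
    rw [Finset.sum_range_succ, Finset.sum_range_succ _ (N + 1)]
    have hq := tsallisArgmin_mem (η (N + 1 + 1)) (C (N + 1))
    have h1 := optValue_le (η (N + 1)) (C (N + 1)) hq
    have h2 := hobj N (C (N + 1)) _ hq
    have h3 := hobj (N + 1) (C (N + 1)) _ hq
    rw [← optValue] at h3
    linarith

/-- At a vertex the regularizer equals -2/η. Spread over the increments of ρ, it turns 4 ∑ √p_i - 2
into 4 (∑ √p_i - 1), and this -1 later absorbs the √p of the best arm. -/
theorem ftrl_regret_le [NeZero K] {η ρ : ℕ → ℝ} (h0 : ρ 0 = 0)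
    (hρ : ∀ n, ρ (n + 1) = (η (n + 1))⁻¹) (C : ℕ → Fin K → ℝ) (hC : C 0 = 0) (N : ℕ)
    (j : Fin K) :
    ∑ n ∈ Finset.range (N + 1), (optValue (η (n + 1)) (C (n + 1)) - optValue (η (n + 1)) (C n)) ≤
      C (N + 1) j + ∑ n ∈ Finset.range (N + 1), (ρ (n + 1) - ρ n) *
        (4 * (∑ i, √(tsallisArgmin (η (n + 1)) (C n) i) - 1)) := by
  have h1 := sum_optValue_sub_le h0 hρ C hC N
  have h2 := optValue_le (η (N + 1)) (C (N + 1)) (single_mem_stdSimplex ℝ j)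
  rw [objective_of_mem_stdSimplex (single_mem_stdSimplex ℝ j)] at h2
  have h3 : ∑ i, (Pi.single (M := fun _ => ℝ) j 1 i * C (N + 1) i
      - 4 / η (N + 1) * √(Pi.single (M := fun _ => ℝ) j 1 i)) =
      C (N + 1) j - 4 / η (N + 1) := by
    rw [Finset.sum_eq_single j (fun k _ hk => by simp [hk]) (by simp)]
    simp
  have h4 : ∑ n ∈ Finset.range (N + 1), (ρ (n + 1) - ρ n) *
      (4 * ∑ i, √(tsallisArgmin (η (n + 1)) (C n) i) - 2) =
      ∑ n ∈ Finset.range (N + 1), (ρ (n + 1) - ρ n) *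
        (4 * (∑ i, √(tsallisArgmin (η (n + 1)) (C n) i) - 1)) + 2 / η (N + 1) := by
    have h5 := Finset.sum_range_sub ρ (N + 1)
    rw [h0, hρ, sub_zero] at h5
    rw [div_eq_mul_inv, ← h5, Finset.mul_sum, ← Finset.sum_add_distrib]
    exact Finset.sum_congr rfl fun n _ => by ring
  rw [h3] at h2
  rw [h4] at h1
  have h6 : 4 / η (N + 1) = 2 / η (N + 1) + 2 / η (N + 1) := by ring
  linarith

theorem cumEstimate_succ (η : ℕ → ℝ) (len : ℕ → ℕ) (ℓ : ℕ → Fin K → ℝ) (I : ℕ → Fin K) (n : ℕ) :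
    cumEstimate η len ℓ I (n + 1) = cumEstimate η len ℓ I n + Pi.single (I (n + 1))
      (blockLoss len ℓ (n + 1) (I (n + 1)) /
        tsallisArgmin (η (n + 1)) (cumEstimate η len ℓ I n) (I (n + 1))) := by
  funext i
  rcases eq_or_ne (I (n + 1)) i with rfl | h
  · simp [cumEstimate]
  · simp [cumEstimate, h, h.symm]

/-- Along every sequence of draws, the regret against the loss estimates is at most the sum of the
stability terms and of the penalty terms. -/
theorem pathwise_regret_le [NeZero K] {η ρ : ℕ → ℝ} (hη : ∀ n, 0 < η (n + 1)) (h0 : ρ 0 = 0)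
    (hρ : ∀ n, ρ (n + 1) = (η (n + 1))⁻¹) (len : ℕ → ℕ) (ℓ : ℕ → Fin K → ℝ) (I : ℕ → Fin K)
    (N : ℕ) (j : Fin K) :
    ∑ n ∈ Finset.range (N + 1), blockLoss len ℓ (n + 1) (I (n + 1)) ≤
      cumEstimate η len ℓ I (N + 1) j + ∑ n ∈ Finset.range (N + 1),
        (stepStability (η (n + 1)) (cumEstimate η len ℓ I n) (I (n + 1))
          (blockLoss len ℓ (n + 1) (I (n + 1)))
        + (ρ (n + 1) - ρ n) * (4 * (∑ i, √(samplingDist η len ℓ I (n + 1) i) - 1))) := by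
  have h1 := ftrl_regret_le h0 hρ (cumEstimate η len ℓ I) rfl N j
  have h2 : ∀ n, stepStability (η (n + 1)) (cumEstimate η len ℓ I n) (I (n + 1))
          (blockLoss len ℓ (n + 1) (I (n + 1))) = blockLoss len ℓ (n + 1) (I (n + 1)) -
        (optValue (η (n + 1)) (cumEstimate η len ℓ I (n + 1))
          - optValue (η (n + 1)) (cumEstimate η len ℓ I n)) := fun n => by
    -- The inner product of p with the estimate is exactly the incurred block loss, since p_i
    -- cancels.
    rw [stepStability, ← cumEstimate_succ,
      Finset.sum_eq_single (I (n + 1)) (fun k _ hk => by simp [hk]) (by simp), Pi.single_eq_same,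
      mul_div_cancel₀ _ (tsallisArgmin_pos (hη n) _ _).ne']
    ring
  simp only [h2, Finset.sum_add_distrib, Finset.sum_sub_distrib, samplingDist,
    Nat.add_sub_cancel] at h1 ⊢
  linarith

end

section

variable {K : ℕ} {Ω : Type*}

/-! ### Blocks -/

theorem blockEnd_succ (len : ℕ → ℕ) (n : ℕ) :
    blockEnd len (n + 1) = blockEnd len n + len (n + 1) :=
  Finset.sum_Icc_succ_top (by omega) _

theorem blockEnd_mono (len : ℕ → ℕ) : Monotone (blockEnd len) := fun _ _ hab =>
  Finset.sum_le_sum_of_subset (Finset.Icc_subset_Icc_right hab)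

theorem block_succ (len : ℕ → ℕ) (n : ℕ) :
    block len (n + 1) = Finset.Ioc (blockEnd len n) (blockEnd len (n + 1)) := rfl

theorem one_le_of_mem_block {len : ℕ → ℕ} {n t : ℕ} (h : t ∈ block len n) : 1 ≤ t := by
  have := (Finset.mem_Ioc.1 h).1
  omega

theorem card_block_succ (len : ℕ → ℕ) (n : ℕ) : (block len (n + 1)).card = len (n + 1) := by
  rw [block_succ, Nat.card_Ioc, blockEnd_succ]
  omega

theorem sum_block (len : ℕ → ℕ) (f : ℕ → ℝ) (N : ℕ) :
    ∑ n ∈ Finset.range N, ∑ t ∈ block len (n + 1), f t =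
      ∑ t ∈ Finset.Icc 1 (blockEnd len N), f t := by
  induction N with
  | zero => simp [blockEnd]
  | succ N ih =>
    rw [Finset.sum_range_succ, ih, block_succ]
    exact Finset.sum_Ioc_consecutive f (Nat.zero_le _) (blockEnd_mono len N.le_succ)

theorem blockLoss_mem_Icc {len : ℕ → ℕ} {ℓ : ℕ → Fin K → ℝ}
    (hℓ : ∀ t, 1 ≤ t → ∀ i, ℓ t i ∈ Set.Icc (0 : ℝ) 1) (n : ℕ) (i : Fin K) :
    blockLoss len ℓ (n + 1) i ∈ Set.Icc (0 : ℝ) (len (n + 1)) := by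
  refine ⟨Finset.sum_nonneg fun t ht => (hℓ t (one_le_of_mem_block ht) i).1, ?_⟩
  have h := Finset.sum_le_card_nsmul (block len (n + 1)) (fun t => ℓ t i) 1
    fun t ht => (hℓ t (one_le_of_mem_block ht) i).2
  rwa [card_block_succ, nsmul_eq_mul, mul_one] at h

/-- Causality: it allows losses after the horizon to be zeroed and past draws to be frozen to a
fixed path. -/
theorem cumEstimate_congr (η : ℕ → ℝ) {len : ℕ → ℕ} {ℓ ℓ' : ℕ → Fin K → ℝ} {I I' : ℕ → Fin K}
    {n : ℕ} (hℓ : ∀ t, 1 ≤ t → t ≤ blockEnd len n → ℓ t = ℓ' t)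
    (hI : ∀ k, 1 ≤ k → k ≤ n → I k = I' k) :
    cumEstimate η len ℓ I n = cumEstimate η len ℓ' I' n := by
  induction n with
  | zero => rfl
  | succ n ih =>
    rw [cumEstimate_succ, cumEstimate_succ, ih (fun t h1 h2 => hℓ t h1
      (h2.trans (blockEnd_mono len n.le_succ))) fun k h1 h2 => hI k h1 (by omega),
      hI (n + 1) (by omega) le_rfl]
    have h : ∀ i, blockLoss len ℓ (n + 1) i = blockLoss len ℓ' (n + 1) i := fun i =>
      Finset.sum_congr rfl fun t ht => by
        rw [hℓ t (one_le_of_mem_block ht) (Finset.mem_Ioc.1 ht).2]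
    rw [h]

/-! ### Bounds and measurability of the loss estimates -/

theorem exists_cumEstimate_le [NeZero K] {η : ℕ → ℝ} (hη : ∀ n, 0 < η (n + 1)) (len : ℕ → ℕ)
    (n : ℕ) : ∃ M : ℝ, ∀ (ℓ : ℕ → Fin K → ℝ) (I : ℕ → Fin K),
      (∀ t, 1 ≤ t → ∀ i, ℓ t i ∈ Set.Icc (0 : ℝ) 1) →
      ∀ i, 0 ≤ cumEstimate η len ℓ I n i ∧ cumEstimate η len ℓ I n i ≤ M := by
  induction n with
  | zero => exact ⟨0, fun ℓ I _ i => ⟨le_rfl, le_rfl⟩⟩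
  | succ n ih =>
    obtain ⟨M, hM⟩ := ih
    set ε := 4 / (η (n + 1) * (M + 2 * √K / η (n + 1))) ^ 2 with hε
    have hK : 0 < √(K : ℝ) := Real.sqrt_pos.2 (by exact_mod_cast NeZero.pos K)
    have hη' := hη n
    have hM0 : 0 ≤ M := by
      have := hM 0 0 (fun t _ i => by simp) 0
      exact this.1.trans this.2
    have hεpos : 0 < ε := by positivity
    refine ⟨M + len (n + 1) / ε, fun ℓ I hℓ i => ?_⟩
    have hC := hM ℓ I hℓ
    have hl := blockLoss_mem_Icc (len := len) hℓ n (I (n + 1))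
    have hp := le_tsallisArgmin hη' hC (I (n + 1))
    rw [← hε] at hp
    have h1 : 0 ≤ blockLoss len ℓ (n + 1) (I (n + 1)) /
        tsallisArgmin (η (n + 1)) (cumEstimate η len ℓ I n) (I (n + 1)) :=
      div_nonneg hl.1 (hεpos.le.trans hp)
    have h2 : blockLoss len ℓ (n + 1) (I (n + 1)) /
        tsallisArgmin (η (n + 1)) (cumEstimate η len ℓ I n) (I (n + 1)) ≤ len (n + 1) / ε :=
      div_le_div₀ (by positivity) hl.2 hεpos hp
    rw [cumEstimate_succ, Pi.add_apply, Pi.single_apply]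
    have h3 := hC i
    split_ifs
    · constructor <;> linarith
    · have : 0 ≤ (len (n + 1) : ℝ) / ε := by positivity
      constructor <;> linarith

theorem exists_le_samplingDist [NeZero K] {η : ℕ → ℝ} (hη : ∀ n, 0 < η (n + 1)) (len : ℕ → ℕ)
    (n : ℕ) : ∃ ε : ℝ, 0 < ε ∧ ∀ (ℓ : ℕ → Fin K → ℝ) (I : ℕ → Fin K),
      (∀ t, 1 ≤ t → ∀ i, ℓ t i ∈ Set.Icc (0 : ℝ) 1) →
      ∀ i, ε ≤ samplingDist η len ℓ I (n + 1) i := by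
  obtain ⟨M, hM⟩ := exists_cumEstimate_le (K := K) hη len n
  have hK : 0 < √(K : ℝ) := Real.sqrt_pos.2 (by exact_mod_cast NeZero.pos K)
  have hη' := hη n
  have hM0 : 0 ≤ M := by
    have := hM 0 0 (fun t _ i => by simp) 0
    exact this.1.trans this.2
  exact ⟨4 / (η (n + 1) * (M + 2 * √K / η (n + 1))) ^ 2, by positivity,
    fun ℓ I hℓ i => le_tsallisArgmin hη' (hM ℓ I hℓ) i⟩

theorem samplingDist_mem [NeZero K] (η : ℕ → ℝ) (len : ℕ → ℕ) (ℓ : ℕ → Fin K → ℝ)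
    (I : ℕ → Fin K) (n : ℕ) : samplingDist η len ℓ I n ∈ stdSimplex ℝ (Fin K) :=
  tsallisArgmin_mem _ _

theorem samplingDist_pos [NeZero K] {η : ℕ → ℝ} (hη : ∀ n, 0 < η (n + 1)) (len : ℕ → ℕ)
    (ℓ : ℕ → Fin K → ℝ) (I : ℕ → Fin K) (n : ℕ) (i : Fin K) :
    0 < samplingDist η len ℓ I (n + 1) i :=
  tsallisArgmin_pos (hη n) _ _

theorem samplingDist_le_one [NeZero K] (η : ℕ → ℝ) (len : ℕ → ℕ) (ℓ : ℕ → Fin K → ℝ)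
    (I : ℕ → Fin K) (n : ℕ) (i : Fin K) : samplingDist η len ℓ I n i ≤ 1 :=
  (mem_Icc_of_mem_stdSimplex (samplingDist_mem η len ℓ I n) i).2

theorem measurable_blockLoss {m : MeasurableSpace Ω} {ℓ : ℕ → Ω → Fin K → ℝ} {len : ℕ → ℕ} {n : ℕ}
    (hℓ : ∀ t, 1 ≤ t → t ≤ blockEnd len n → Measurable[m] (ℓ t)) (i : Fin K) :
    Measurable[m] fun ω => blockLoss len (fun t => ℓ t ω) n i := by
  refine Finset.measurable_fun_sum _ fun t ht => ?_
  exact (measurable_pi_apply i).comp (hℓ t (one_le_of_mem_block ht) (Finset.mem_Ioc.1 ht).2)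

theorem measurable_cumEstimate [NeZero K] {m : MeasurableSpace Ω} {η : ℕ → ℝ}
    (hη : ∀ n, 0 < η (n + 1)) {len : ℕ → ℕ} {ℓ : ℕ → Ω → Fin K → ℝ} {I : ℕ → Ω → Fin K} {n : ℕ}
    (hℓ : ∀ t, 1 ≤ t → t ≤ blockEnd len n → Measurable[m] (ℓ t))
    (hI : ∀ k, 1 ≤ k → k ≤ n → Measurable[m] (I k)) :
    Measurable[m] fun ω => cumEstimate η len (fun t => ℓ t ω) (fun k => I k ω) n := by
  induction n with
  | zero => exact measurable_const
  | succ n ih =>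
    have h1 := ih (fun t ht1 ht2 => hℓ t ht1 (ht2.trans (blockEnd_mono len n.le_succ)))
      fun k hk1 hk2 => hI k hk1 (by omega)
    refine measurable_pi_lambda _ fun i => ?_
    have hi : Measurable[m] fun ω => if I (n + 1) ω = i then
        blockLoss len (fun t => ℓ t ω) (n + 1) i /
          tsallisArgmin (η (n + 1)) (cumEstimate η len (fun t => ℓ t ω) (fun k => I k ω) n) i
        else 0 := by
      refine Measurable.ite ?_ (Measurable.div (measurable_blockLoss hℓ i) ?_) measurable_const
      · exact hI (n + 1) (by omega) le_rfl (measurableSet_singleton i)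
      · exact (measurable_pi_apply i).comp
          ((continuous_tsallisArgmin (hη n)).measurable.comp h1)
    exact ((measurable_pi_apply i).comp h1).add hi

theorem measurable_samplingDist [NeZero K] {m : MeasurableSpace Ω} {η : ℕ → ℝ}
    (hη : ∀ n, 0 < η (n + 1)) {len : ℕ → ℕ} {ℓ : ℕ → Ω → Fin K → ℝ} {I : ℕ → Ω → Fin K} {n : ℕ}
    (hℓ : ∀ t, 1 ≤ t → t ≤ blockEnd len n → Measurable[m] (ℓ t))
    (hI : ∀ k, 1 ≤ k → k ≤ n → Measurable[m] (I k)) :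
    Measurable[m] fun ω => samplingDist η len (fun t => ℓ t ω) (fun k => I k ω) (n + 1) :=
  (continuous_tsallisArgmin (hη n)).measurable.comp (measurable_cumEstimate hη hℓ hI)

/-! ### Information available at a draw -/

theorem measurable_loss_drawInfo (ℓ : ℕ → Ω → Fin K → ℝ) (I : ℕ → Ω → Fin K) (n : ℕ) {t : ℕ}
    (ht : 1 ≤ t) : Measurable[drawInfo ℓ I n] (ℓ t) :=
  Measurable.of_comap_le ((le_iSup₂ (f := fun t (_ : 1 ≤ t) =>
    MeasurableSpace.comap (ℓ t) inferInstance) t ht).trans le_sup_left)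

theorem measurable_draw_drawInfo (ℓ : ℕ → Ω → Fin K → ℝ) (I : ℕ → Ω → Fin K) {n k : ℕ}
    (h1 : 1 ≤ k) (hk : k < n) : Measurable[drawInfo ℓ I n] (I k) :=
  Measurable.of_comap_le ((le_iSup₂ (f := fun k (_ : k ∈ Finset.Ico 1 n) =>
    MeasurableSpace.comap (I k) ⊤) k (Finset.mem_Ico.2 ⟨h1, hk⟩)).trans le_sup_right)

theorem measurable_samplingDist_drawInfo [NeZero K] {η : ℕ → ℝ}
    (hη : ∀ n, 0 < η (n + 1)) (len : ℕ → ℕ) (ℓ : ℕ → Ω → Fin K → ℝ) (I : ℕ → Ω → Fin K) (n : ℕ) :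
    Measurable[drawInfo ℓ I (n + 1)]
      fun ω => samplingDist η len (fun t => ℓ t ω) (fun k => I k ω) (n + 1) :=
  measurable_samplingDist hη (fun _ ht _ => measurable_loss_drawInfo ℓ I _ ht)
    fun _ h1 h2 => measurable_draw_drawInfo ℓ I h1 (by omega)

variable [MeasurableSpace Ω] {μ : Measure Ω} {η : ℕ → ℝ} {len : ℕ → ℕ}
  {ℓ : ℕ → Ω → Fin K → ℝ} {I : ℕ → Ω → Fin K}

theorem drawInfo_le (hℓ : IsLossProcess ℓ) (hI : IsTsallisSwitchRun μ η len ℓ I) (n : ℕ) :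
    drawInfo ℓ I n ≤ ‹MeasurableSpace Ω› := by
  refine sup_le (iSup₂_le fun t ht => (hℓ.measurable t ht).comap_le) (iSup₂_le fun k hk => ?_)
  exact (hI.measurable k (Finset.mem_Ico.1 hk).1).comap_le

theorem integrable_of_abs_le [IsFiniteMeasure μ] {f : Ω → ℝ} (hf : Measurable f) {M : ℝ}
    (hM : ∀ ω, |f ω| ≤ M) : Integrable f μ :=
  Integrable.of_bound hf.aestronglyMeasurable M (ae_of_all _ hM)

/-- Averaging over the draw of the `n`-th block, against a bounded quantity that is known before
that draw. -/
theorem integral_ite_draw_eq [IsProbabilityMeasure μ] (hℓ : IsLossProcess ℓ)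
    (hI : IsTsallisSwitchRun μ η len ℓ I) {n : ℕ} (hn : 1 ≤ n) (i : Fin K) {Z : Ω → ℝ}
    (hZ : Measurable[drawInfo ℓ I n] Z) {M : ℝ} (hM : ∀ ω, |Z ω| ≤ M) :
    ∫ ω, (if I n ω = i then Z ω else 0) ∂μ =
      ∫ ω, samplingDist η len (fun t => ℓ t ω) (fun k => I k ω) n i * Z ω ∂μ := by
  have hm := drawInfo_le hℓ hI n
  have hset : MeasurableSet {ω | I n ω = i} := hI.measurable n hn (measurableSet_singleton i)
  have hint : Integrable ({ω | I n ω = i}.indicator fun _ => (1 : ℝ)) μ :=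
    (integrable_const 1).indicator hset
  have h1 := condExp_stronglyMeasurable_mul_of_bound hm (μ := μ) hZ.stronglyMeasurable hint M
    (ae_of_all _ hM)
  calc ∫ ω, (if I n ω = i then Z ω else 0) ∂μ
      = ∫ ω, (Z * {ω | I n ω = i}.indicator fun _ => (1 : ℝ)) ω ∂μ := by
        refine integral_congr_ae (ae_of_all _ fun ω => ?_)
        by_cases h : I n ω = i <;> simp [h]
    _ = ∫ ω, (μ[Z * {ω | I n ω = i}.indicator fun _ => (1 : ℝ) | drawInfo ℓ I n]) ω ∂μ :=
        (integral_condExp hm).symm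
    _ = _ := by
        refine integral_congr_ae ?_
        filter_upwards [h1, hI.condProb_eq n hn i] with ω h2 h3
        rw [h2, Pi.mul_apply, h3, mul_comm]

end

section

variable {K : ℕ} {Ω : Type*}

/-! ### Expected regret over the first blocks -/

/-- The loss sequence cut off after round `T`. -/
def truncLoss (T : ℕ) (ℓ : ℕ → Fin K → ℝ) (t : ℕ) : Fin K → ℝ := if t ≤ T then ℓ t else 0

theorem truncLoss_mem_Icc {T : ℕ} {ℓ : ℕ → Fin K → ℝ}
    (hℓ : ∀ t, 1 ≤ t → ∀ i, ℓ t i ∈ Set.Icc (0 : ℝ) 1) (t : ℕ) (ht : 1 ≤ t) (i : Fin K) :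
    truncLoss T ℓ t i ∈ Set.Icc (0 : ℝ) 1 := by
  unfold truncLoss
  split_ifs
  · exact hℓ t ht i
  · simp

theorem blockIndex_of_mem_block {len : ℕ → ℕ} (hlen : ∀ n, 1 ≤ len n) {t n : ℕ}
    (h : t ∈ block len (n + 1)) : blockIndex len t = n + 1 :=
  (blockIndex_eq_iff len hlen (by omega)).2 h

theorem le_blockEnd_blockIndex {len : ℕ → ℕ} (hlen : ∀ n, 1 ≤ len n) (t : ℕ) :
    t ≤ blockEnd len (blockIndex len t) := by
  refine Nat.sInf_mem (s := {n | t ≤ blockEnd len n}) ⟨t, ?_⟩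
  have h := Finset.card_nsmul_le_sum (Finset.Icc 1 t) len 1 (fun m _ => hlen m)
  simpa [blockEnd] using h

theorem one_le_blockIndex {len : ℕ → ℕ} (hlen : ∀ n, 1 ≤ len n) {t : ℕ} (ht : 1 ≤ t) :
    1 ≤ blockIndex len t := by
  by_contra h
  have h1 := le_blockEnd_blockIndex hlen t
  rw [show blockIndex len t = 0 by omega] at h1
  simp only [blockEnd, Finset.Icc_eq_empty_of_lt zero_lt_one, Finset.sum_empty] at h1
  omega

theorem sum_blockLoss_truncLoss (len : ℕ → ℕ) (ℓ : ℕ → Fin K → ℝ) (a : ℕ → Fin K) {T N : ℕ}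
    (hT : T ≤ blockEnd len N) (hlen : ∀ n, 1 ≤ len n) :
    ∑ n ∈ Finset.range N, blockLoss len (truncLoss T ℓ) (n + 1) (a (n + 1)) =
      ∑ t ∈ Finset.Icc 1 T, ℓ t (a (blockIndex len t)) := by
  have h1 : ∑ n ∈ Finset.range N, blockLoss len (truncLoss T ℓ) (n + 1) (a (n + 1)) =
      ∑ n ∈ Finset.range N, ∑ t ∈ block len (n + 1),
        if t ≤ T then ℓ t (a (blockIndex len t)) else 0 := by
    refine Finset.sum_congr rfl fun n _ => Finset.sum_congr rfl fun t ht => ?_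
    rw [blockIndex_of_mem_block hlen ht, truncLoss]
    split_ifs <;> rfl
  rw [h1, sum_block, ← Finset.sum_filter]
  congr 1
  ext t
  simp only [Finset.mem_filter, Finset.mem_Icc]
  omega

theorem cumEstimate_eq_sum (η : ℕ → ℝ) (len : ℕ → ℕ) (ℓ : ℕ → Fin K → ℝ) (I : ℕ → Fin K) (N : ℕ)
    (j : Fin K) : cumEstimate η len ℓ I N j = ∑ n ∈ Finset.range N, if I (n + 1) = j then
      blockLoss len ℓ (n + 1) j / samplingDist η len ℓ I (n + 1) j else 0 := by
  induction N with
  | zero => rfl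
  | succ N ih => rw [Finset.sum_range_succ, ← ih]; rfl

variable [MeasurableSpace Ω] {μ : Measure Ω} {η : ℕ → ℝ} {len : ℕ → ℕ}
  {ℓ : ℕ → Ω → Fin K → ℝ} {I : ℕ → Ω → Fin K}

theorem abs_le_one_of_mem_Icc {x : ℝ} (hx : x ∈ Set.Icc (0 : ℝ) 1) : |x| ≤ 1 := by
  rw [abs_of_nonneg hx.1]
  exact hx.2

theorem measurable_apply_draw {a : Ω → Fin K} (ha : Measurable a) {f : Fin K → Ω → ℝ}
    (hf : ∀ i, Measurable (f i)) : Measurable fun ω => f (a ω) ω := by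
  have h : (fun ω => f (a ω) ω) = fun ω => ∑ i, if a ω = i then f i ω else 0 := by
    funext ω
    simp
  rw [h]
  exact Finset.measurable_fun_sum _ fun i _ =>
    Measurable.ite (ha (measurableSet_singleton i)) (hf i) measurable_const

/-- The expectation of a bounded quantity known before the draw, except for its dependence on the
drawn arm. -/
theorem integral_apply_draw_eq [NeZero K] [IsProbabilityMeasure μ] (hη : ∀ n, 0 < η (n + 1))
    (hℓ : IsLossProcess ℓ) (hI : IsTsallisSwitchRun μ η len ℓ I) (n : ℕ) {Z : Fin K → Ω → ℝ}
    (hZ : ∀ i, Measurable[drawInfo ℓ I (n + 1)] (Z i)) {M : ℝ} (hM : ∀ i ω, |Z i ω| ≤ M) :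
    ∫ ω, Z (I (n + 1) ω) ω ∂μ =
      ∫ ω, ∑ i, samplingDist η len (fun t => ℓ t ω) (fun k => I k ω) (n + 1) i * Z i ω ∂μ := by
  have hm := drawInfo_le hℓ hI (n + 1)
  have hIm := hI.measurable (n + 1) (by omega)
  have hpm : ∀ i, Measurable fun ω =>
      samplingDist η len (fun t => ℓ t ω) (fun k => I k ω) (n + 1) i := fun i =>
    (measurable_pi_apply i).comp ((measurable_samplingDist_drawInfo hη len ℓ I n).mono hm le_rfl)
  have h : (fun ω => Z (I (n + 1) ω) ω) = fun ω => ∑ i, if I (n + 1) ω = i then Z i ω else 0 := by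
    funext ω
    simp
  rw [h, integral_finsetSum, integral_finsetSum]
  · exact Finset.sum_congr rfl fun i _ => integral_ite_draw_eq hℓ hI (by omega) i (hZ i) (hM i)
  · intro i _
    refine integrable_of_abs_le (M := M) ((hpm i).mul ((hZ i).mono hm le_rfl)) fun ω => ?_
    have h0 := (samplingDist_pos hη len (fun t => ℓ t ω) (fun k => I k ω) n i).le
    rw [abs_mul, abs_of_nonneg h0]
    exact (mul_le_of_le_one_left (abs_nonneg _) (samplingDist_le_one _ _ _ _ _ _)).trans (hM i ω)
  · intro i _
    refine integrable_of_abs_le (M := M) (Measurable.ite (hIm (measurableSet_singleton i))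
      ((hZ i).mono hm le_rfl) measurable_const) fun ω => ?_
    split_ifs
    · exact hM i ω
    · simpa using (abs_nonneg _).trans (hM i ω)

theorem integrable_sum_loss [IsProbabilityMeasure μ] (hℓ : IsLossProcess ℓ)
    {a : ℕ → Ω → Fin K} (ha : ∀ t, 1 ≤ t → Measurable (a t)) (T : ℕ) :
    Integrable (fun ω => ∑ t ∈ Finset.Icc 1 T, ℓ t ω (a t ω)) μ := by
  refine integrable_finsetSum _ fun t ht => ?_
  have ht := (Finset.mem_Icc.1 ht).1
  exact integrable_of_abs_le (M := 1) (measurable_apply_draw (ha t ht) fun i =>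
    (measurable_pi_apply i).comp (hℓ.measurable t ht))
    fun ω => abs_le_one_of_mem_Icc (hℓ.mem_Icc t ht ω _)

/-- Cutting off the last block is modelled by zero losses after T. Draws whose preceding blocks end
by T are unaffected, so the run itself need not be changed. -/
theorem samplingDist_truncLoss (η : ℕ → ℝ) {len : ℕ → ℕ} (L : ℕ → Fin K → ℝ) (J : ℕ → Fin K)
    {T n : ℕ} (hT : blockEnd len n ≤ T) :
    samplingDist η len (truncLoss T L) J (n + 1) = samplingDist η len L J (n + 1) := by
  unfold samplingDist
  rw [Nat.add_sub_cancel, cumEstimate_congr η (ℓ := truncLoss T L) (ℓ' := L) (I' := J)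
    (fun t _ ht => if_pos (ht.trans hT)) fun _ _ _ => rfl]

/-- Unbiasedness of the importance-weighted loss estimates. -/
theorem integral_cumEstimate [NeZero K] [IsProbabilityMeasure μ]
    (hη : ∀ n, 0 < η (n + 1)) (hlen : ∀ n, 1 ≤ len n) (hℓ : IsLossProcess ℓ)
    (hI : IsTsallisSwitchRun μ η len ℓ I) {T N : ℕ} (hN : blockEnd len N ≤ T)
    (hT : T ≤ blockEnd len (N + 1)) (j : Fin K) :
    Integrable (fun ω => cumEstimate η len (truncLoss T fun t => ℓ t ω) (fun k => I k ω)
      (N + 1) j) μ ∧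
    ∫ ω, cumEstimate η len (truncLoss T fun t => ℓ t ω) (fun k => I k ω) (N + 1) j ∂μ =
      ∫ ω, ∑ t ∈ Finset.Icc 1 T, ℓ t ω j ∂μ := by
  set Z : ℕ → Ω → ℝ := fun n ω => blockLoss len (truncLoss T fun t => ℓ t ω) (n + 1) j /
    samplingDist η len (fun t => ℓ t ω) (fun k => I k ω) (n + 1) j with hZdef
  have htr : ∀ m : MeasurableSpace Ω, (∀ t, 1 ≤ t → Measurable[m] (ℓ t)) → ∀ n,
      Measurable[m] fun ω => blockLoss len (truncLoss T fun t => ℓ t ω) (n + 1) j := by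
    intro m hm n
    refine measurable_blockLoss (ℓ := fun t ω => truncLoss T (fun t => ℓ t ω) t)
      (fun t ht _ => ?_) j
    unfold truncLoss
    split_ifs
    · exact hm t ht
    · exact measurable_const
  have hZm : ∀ n, Measurable[drawInfo ℓ I (n + 1)] (Z n) := fun n =>
    (htr _ (fun t ht => measurable_loss_drawInfo ℓ I _ ht) n).div
      ((measurable_pi_apply j).comp (measurable_samplingDist_drawInfo hη len ℓ I n))
  have hZb : ∀ n, ∃ M, ∀ ω, |Z n ω| ≤ M := fun n => by
    obtain ⟨ε, hε, h⟩ := exists_le_samplingDist (K := K) hη len n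
    refine ⟨len (n + 1) / ε, fun ω => ?_⟩
    have h1 := h (fun t => ℓ t ω) (fun k => I k ω) (fun t ht i => hℓ.mem_Icc t ht ω i) j
    have h2 := blockLoss_mem_Icc (len := len) (truncLoss_mem_Icc (T := T)
      fun t ht i => hℓ.mem_Icc t ht ω i) n j
    rw [abs_of_nonneg (div_nonneg h2.1 (hε.le.trans h1))]
    exact div_le_div₀ (by positivity) h2.2 hε h1
  have hiteI : ∀ n, Integrable (fun ω => if I (n + 1) ω = j then Z n ω else 0) μ := fun n => by
    obtain ⟨M, hM⟩ := hZb n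
    refine integrable_of_abs_le (M := M) (Measurable.ite
      (hI.measurable (n + 1) (by omega) (measurableSet_singleton j))
      ((hZm n).mono (drawInfo_le hℓ hI _) le_rfl) measurable_const) fun ω => ?_
    split_ifs
    · exact hM ω
    · simpa using (abs_nonneg _).trans (hM ω)
  have hblI : ∀ n, Integrable
      (fun ω => blockLoss len (truncLoss T fun t => ℓ t ω) (n + 1) j) μ := fun n => by
    refine integrable_of_abs_le (M := len (n + 1)) (htr _ hℓ.measurable n) fun ω => ?_
    have h2 := blockLoss_mem_Icc (len := len) (truncLoss_mem_Icc (T := T)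
      fun t ht i => hℓ.mem_Icc t ht ω i) n j
    rw [abs_of_nonneg h2.1]
    exact h2.2
  have hsum : (fun ω => cumEstimate η len (truncLoss T fun t => ℓ t ω) (fun k => I k ω) (N + 1) j)
      = fun ω => ∑ n ∈ Finset.range (N + 1), if I (n + 1) ω = j then Z n ω else 0 := by
    funext ω
    rw [cumEstimate_eq_sum]
    refine Finset.sum_congr rfl fun n hn => ?_
    rw [samplingDist_truncLoss η _ _ ((blockEnd_mono len (Finset.mem_range_succ_iff.1 hn)).trans
      hN)]
  rw [hsum]
  refine ⟨integrable_finsetSum _ fun n _ => hiteI n, ?_⟩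
  have hR : (fun ω => ∑ t ∈ Finset.Icc 1 T, ℓ t ω j) = fun ω => ∑ n ∈ Finset.range (N + 1),
      blockLoss len (truncLoss T fun t => ℓ t ω) (n + 1) j := by
    funext ω
    exact (sum_blockLoss_truncLoss len (fun t => ℓ t ω) (fun _ => j) hT hlen).symm
  rw [hR, integral_finsetSum _ fun n _ => hiteI n, integral_finsetSum _ fun n _ => hblI n]
  refine Finset.sum_congr rfl fun n _ => ?_
  obtain ⟨M, hM⟩ := hZb n
  rw [integral_ite_draw_eq hℓ hI (by omega) j (hZm n) hM]
  refine integral_congr_ae (ae_of_all _ fun ω => ?_)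
  exact mul_div_cancel₀ _ (samplingDist_pos hη len _ _ n j).ne'

/-- The expected regret is at most the sum of the expected stability bounds `g` and of the expected
penalties. -/
theorem expected_regret_le [NeZero K] [IsProbabilityMeasure μ]
    (hη : ∀ n, 0 < η (n + 1)) (hlen : ∀ n, 1 ≤ len n) {ρ : ℕ → ℝ} (h0 : ρ 0 = 0)
    (hρ : ∀ n, ρ (n + 1) = (η (n + 1))⁻¹) (hℓ : IsLossProcess ℓ)
    (hI : IsTsallisSwitchRun μ η len ℓ I) {T N : ℕ} (hN : blockEnd len N ≤ T)
    (hT : T ≤ blockEnd len (N + 1)) (j : Fin K) (g : ℕ → Fin K → (Fin K → ℝ) → ℝ)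
    (hgm : ∀ n i, Measurable (g n i))
    (hgb : ∀ n (ε : ℝ), 0 < ε → ∃ M : ℝ, ∀ i, ∀ p ∈ stdSimplex ℝ (Fin K), (∀ k, ε ≤ p k) →
      |g n i p| ≤ M)
    (hg : ∀ n C i c, 0 ≤ c → c ≤ (len (n + 1) : ℝ) →
      stepStability (η (n + 1)) C i c ≤ g n i (tsallisArgmin (η (n + 1)) C)) :
    (∫ ω, ∑ t ∈ Finset.Icc 1 T, ℓ t ω (I (blockIndex len t) ω) ∂μ)
        - ∫ ω, ∑ t ∈ Finset.Icc 1 T, ℓ t ω j ∂μ ≤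
      ∑ n ∈ Finset.range (N + 1), ((∫ ω,
        ∑ i, samplingDist η len (fun t => ℓ t ω) (fun k => I k ω) (n + 1) i *
          g n i (samplingDist η len (fun t => ℓ t ω) (fun k => I k ω) (n + 1)) ∂μ)
        + ∫ ω, (ρ (n + 1) - ρ n) * (4 * (∑ i,
          √(samplingDist η len (fun t => ℓ t ω) (fun k => I k ω) (n + 1) i) - 1)) ∂μ) := by
  set p : ℕ → Ω → Fin K → ℝ := fun n ω =>
    samplingDist η len (fun t => ℓ t ω) (fun k => I k ω) (n + 1) with hp
  have hpd : ∀ n, Measurable[drawInfo ℓ I (n + 1)] (p n) :=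
    measurable_samplingDist_drawInfo hη len ℓ I
  have hpm : ∀ n, Measurable (p n) := fun n => (hpd n).mono (drawInfo_le hℓ hI _) le_rfl
  have hZm : ∀ n i, Measurable[drawInfo ℓ I (n + 1)] fun ω => g n i (p n ω) := fun n i =>
    (hgm n i).comp (hpd n)
  have hZb : ∀ n, ∃ M, ∀ i ω, |g n i (p n ω)| ≤ M := fun n => by
    obtain ⟨ε, hε, h⟩ := exists_le_samplingDist (K := K) hη len n
    obtain ⟨M, hM⟩ := hgb n ε hε
    exact ⟨M, fun i ω => hM i _ (samplingDist_mem _ _ _ _ _)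
      (h (fun t => ℓ t ω) (fun k => I k ω) fun t ht i => hℓ.mem_Icc t ht ω i)⟩
  have hstabI : ∀ n, Integrable (fun ω => g n (I (n + 1) ω) (p n ω)) μ := fun n => by
    obtain ⟨M, hM⟩ := hZb n
    exact integrable_of_abs_le (measurable_apply_draw (hI.measurable (n + 1) (by omega))
      fun i => (hZm n i).mono (drawInfo_le hℓ hI _) le_rfl) fun ω => hM _ ω
  have hpenI : ∀ n, Integrable
      (fun ω => (ρ (n + 1) - ρ n) * (4 * (∑ i, √(p n ω i) - 1))) μ := fun n => by
    refine (((integrable_finsetSum _ fun i _ => ?_).sub (integrable_const 1)).const_mul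
      4).const_mul _
    refine integrable_of_abs_le (M := 1) ((measurable_pi_apply i).comp (hpm n)).sqrt fun ω => ?_
    rw [abs_of_nonneg (Real.sqrt_nonneg _)]
    exact Real.sqrt_le_one.2 (samplingDist_le_one _ _ _ _ _ _)
  obtain ⟨hCI, hCint⟩ := integral_cumEstimate hη hlen hℓ hI hN hT j
  have hlossI : Integrable (fun ω => ∑ t ∈ Finset.Icc 1 T, ℓ t ω (I (blockIndex len t) ω)) μ := by
    refine integrable_sum_loss hℓ (fun t ht => hI.measurable _ (one_le_blockIndex hlen ht)) T
  have hpath : ∀ ω, ∑ t ∈ Finset.Icc 1 T, ℓ t ω (I (blockIndex len t) ω) ≤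
      cumEstimate η len (truncLoss T fun t => ℓ t ω) (fun k => I k ω) (N + 1) j +
        ∑ n ∈ Finset.range (N + 1), (g n (I (n + 1) ω) (p n ω) +
          (ρ (n + 1) - ρ n) * (4 * (∑ i, √(p n ω i) - 1))) := by
    intro ω
    have h1 := pathwise_regret_le hη h0 hρ len (truncLoss T fun t => ℓ t ω) (fun k => I k ω) N j
    rw [sum_blockLoss_truncLoss len (fun t => ℓ t ω) (fun k => I k ω) hT hlen] at h1
    refine h1.trans (add_le_add le_rfl (Finset.sum_le_sum fun n hn => ?_))
    have h2 := blockLoss_mem_Icc (len := len) (truncLoss_mem_Icc (T := T)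
      fun t ht i => hℓ.mem_Icc t ht ω i) n (I (n + 1) ω)
    have h3 : samplingDist η len (truncLoss T fun t => ℓ t ω) (fun k => I k ω) (n + 1) = p n ω :=
      samplingDist_truncLoss η (fun t => ℓ t ω) (fun k => I k ω)
        ((blockEnd_mono len (Finset.mem_range_succ_iff.1 hn)).trans hN)
    rw [← h3]
    exact add_le_add (hg n _ _ _ h2.1 h2.2) le_rfl
  have htermI : ∀ n, Integrable (fun ω => g n (I (n + 1) ω) (p n ω) +
      (ρ (n + 1) - ρ n) * (4 * (∑ i, √(p n ω i) - 1))) μ := fun n => (hstabI n).add (hpenI n)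
  have hsumI : Integrable (fun ω => ∑ n ∈ Finset.range (N + 1), (g n (I (n + 1) ω) (p n ω) +
      (ρ (n + 1) - ρ n) * (4 * (∑ i, √(p n ω i) - 1)))) μ :=
    integrable_finsetSum _ fun n _ => htermI n
  have h1 := integral_mono hlossI (hCI.add hsumI) hpath
  rw [integral_add' hCI hsumI, hCint, integral_finsetSum _ fun n _ => htermI n] at h1
  rw [sub_le_iff_le_add']
  refine h1.trans_eq ?_
  congr 1
  refine Finset.sum_congr rfl fun n _ => ?_
  obtain ⟨M, hM⟩ := hZb n
  rw [integral_add (hstabI n) (hpenI n), integral_apply_draw_eq hη hℓ hI n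
    (Z := fun i ω => g n i (p n ω)) (hZm n) hM]

end

section

variable {K : ℕ} {Ω : Type*}

/-! ### Switches -/

theorem playedArm_of_mem_block {len : ℕ → ℕ} (hlen : ∀ n, 1 ≤ len n) (I : ℕ → Ω → Fin K) {t n : ℕ}
    (h : t ∈ block len (n + 1)) (ω : Ω) : playedArm len I t ω = some (I (n + 1) ω) := by
  have := one_le_of_mem_block h
  rw [playedArm, if_neg (by omega), blockIndex_of_mem_block hlen h]

theorem blockEnd_succ_mem_block {len : ℕ → ℕ} (hlen : ∀ n, 1 ≤ len n) (n : ℕ) :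
    blockEnd len (n + 1) ∈ block len (n + 1) := by
  have := hlen (n + 1)
  rw [block_succ, Finset.mem_Ioc, blockEnd_succ]
  omega

theorem blockEnd_add_one_mem_block {len : ℕ → ℕ} (hlen : ∀ n, 1 ≤ len n) (n : ℕ) :
    blockEnd len n + 1 ∈ block len (n + 1) := by
  have := hlen (n + 1)
  rw [block_succ, Finset.mem_Ioc, blockEnd_succ]
  omega

/-! ### Past losses -/

theorem measurable_loss_pastLosses (ℓ : ℕ → Ω → Fin K → ℝ) {s t : ℕ} (h1 : 1 ≤ s) (hs : s < t) :
    Measurable[pastLosses ℓ t] (ℓ s) :=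
  Measurable.of_comap_le (le_iSup₂ (f := fun s (_ : s ∈ Finset.Ico 1 t) =>
    MeasurableSpace.comap (ℓ s) inferInstance) s (Finset.mem_Ico.2 ⟨h1, hs⟩))

theorem pastLosses_le_drawInfo (ℓ : ℕ → Ω → Fin K → ℝ) (I : ℕ → Ω → Fin K) (t n : ℕ) :
    pastLosses ℓ t ≤ drawInfo ℓ I n :=
  iSup₂_le fun _ hs => (measurable_loss_drawInfo ℓ I n (Finset.mem_Ico.1 hs).1).comap_le

section Prob

variable [MeasurableSpace Ω] {μ : Measure Ω} {η : ℕ → ℝ} {len : ℕ → ℕ}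
  {ℓ : ℕ → Ω → Fin K → ℝ} {I : ℕ → Ω → Fin K}

/-- Only the first round of a block can be a switch. -/
theorem sum_switch_le (hlen : ∀ n, 1 ≤ len n) {T N : ℕ} (hT : T ≤ blockEnd len N) :
    ∑ t ∈ Finset.Icc 1 T, μ.real {ω | playedArm len I (t - 1) ω ≠ playedArm len I t ω} ≤
      ∑ n ∈ Finset.range N,
        μ.real {ω | playedArm len I (blockEnd len n) ω ≠ some (I (n + 1) ω)} := by
  calc ∑ t ∈ Finset.Icc 1 T, μ.real {ω | playedArm len I (t - 1) ω ≠ playedArm len I t ω}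
      ≤ ∑ t ∈ Finset.Icc 1 (blockEnd len N),
          μ.real {ω | playedArm len I (t - 1) ω ≠ playedArm len I t ω} :=
        Finset.sum_le_sum_of_subset_of_nonneg (Finset.Icc_subset_Icc_right hT)
          fun _ _ _ => measureReal_nonneg
    _ = ∑ n ∈ Finset.range N, ∑ t ∈ block len (n + 1),
          μ.real {ω | playedArm len I (t - 1) ω ≠ playedArm len I t ω} := (sum_block len _ N).symm
    _ = _ := by
        refine Finset.sum_congr rfl fun n _ => ?_
        rw [Finset.sum_eq_single (blockEnd len n + 1)]
        · simp only [Nat.add_sub_cancel,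
            playedArm_of_mem_block hlen I (blockEnd_add_one_mem_block hlen n)]
        · intro t ht hne
          have ht' : t - 1 ∈ block len (n + 1) := by
            rw [block_succ, Finset.mem_Ioc] at ht ⊢
            omega
          simp [playedArm_of_mem_block hlen I ht, playedArm_of_mem_block hlen I ht']
        · exact fun h => absurd (blockEnd_add_one_mem_block hlen n) h

theorem measureReal_draw_ne [NeZero K] [IsProbabilityMeasure μ] (hη : ∀ n, 0 < η (n + 1))
    (hℓ : IsLossProcess ℓ) (hI : IsTsallisSwitchRun μ η len ℓ I) (n : ℕ) (j : Fin K) :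
    μ.real {ω | I (n + 1) ω ≠ j} = ∫ ω, ∑ i ∈ Finset.univ.erase j,
      samplingDist η len (fun t => ℓ t ω) (fun k => I k ω) (n + 1) i ∂μ := by
  have h := integral_apply_draw_eq hη hℓ hI n (Z := fun i _ => if i = j then 0 else 1) (M := 1)
    (fun i => measurable_const) fun i ω => by split_ifs <;> simp
  have hs : MeasurableSet {ω | I (n + 1) ω ≠ j} :=
    (hI.measurable (n + 1) (by omega) (measurableSet_singleton j)).compl
  calc μ.real {ω | I (n + 1) ω ≠ j} = ∫ ω, {ω | I (n + 1) ω ≠ j}.indicator 1 ω ∂μ :=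
        (integral_indicator_one hs).symm
    _ = ∫ ω, (if I (n + 1) ω = j then 0 else 1) ∂μ := by
        refine integral_congr_ae (ae_of_all _ fun ω => ?_)
        by_cases h : I (n + 1) ω = j <;> simp [h]
    _ = _ := by
        rw [h]
        refine integral_congr_ae (ae_of_all _ fun ω => ?_)
        simp only
        rw [← Finset.add_sum_erase _ _ (Finset.mem_univ j), if_pos rfl, mul_zero, zero_add]
        exact Finset.sum_congr rfl fun i hi => by rw [if_neg (Finset.ne_of_mem_erase hi), mul_one]

/-- If two consecutive draws differ, one of them is not j. Each draw borders at most two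
transitions, hence the factor 2; the summand 1 is the switch in round 1. -/
theorem sum_switch_le_suboptimal [NeZero K] [IsProbabilityMeasure μ] (hη : ∀ n, 0 < η (n + 1))
    (hlen : ∀ n, 1 ≤ len n) (hℓ : IsLossProcess ℓ) (hI : IsTsallisSwitchRun μ η len ℓ I) {T N : ℕ}
    (hT : T ≤ blockEnd len (N + 1)) (j : Fin K) :
    ∑ t ∈ Finset.Icc 1 T, μ.real {ω | playedArm len I (t - 1) ω ≠ playedArm len I t ω} ≤
      1 + 2 * ∑ n ∈ Finset.range (N + 1), ∫ ω, ∑ i ∈ Finset.univ.erase j,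
        samplingDist η len (fun t => ℓ t ω) (fun k => I k ω) (n + 1) i ∂μ := by
  simp only [← measureReal_draw_ne hη hℓ hI]
  refine (sum_switch_le hlen hT).trans ?_
  rw [Finset.sum_range_succ']
  have h1 : ∀ n, μ.real {ω | playedArm len I (blockEnd len (n + 1)) ω ≠ some (I (n + 1 + 1) ω)} ≤
      μ.real {ω | I (n + 1) ω ≠ j} + μ.real {ω | I (n + 1 + 1) ω ≠ j} := fun n => by
    refine (measureReal_mono ?_).trans (measureReal_union_le _ _)
    intro ω hω
    simp only [playedArm_of_mem_block hlen I (blockEnd_succ_mem_block hlen n), ne_eq,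
      Option.some.injEq, Set.mem_ofPred_eq, Set.mem_union] at hω ⊢
    by_contra! h
    exact hω (h.1.trans h.2.symm)
  have h2 := Finset.sum_le_sum fun n (_ : n ∈ Finset.range N) => h1 n
  rw [Finset.sum_add_distrib] at h2
  have h3 := Finset.sum_range_succ (fun n => μ.real {ω | I (n + 1) ω ≠ j}) N
  have h4 := Finset.sum_range_succ' (fun n => μ.real {ω | I (n + 1) ω ≠ j}) N
  have h5 : 0 ≤ μ.real {ω | I (N + 1) ω ≠ j} := measureReal_nonneg
  have h6 : 0 ≤ μ.real {ω | I (0 + 1) ω ≠ j} := measureReal_nonneg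
  have h7 : μ.real {ω | playedArm len I (blockEnd len 0) ω ≠ some (I (0 + 1) ω)} ≤ 1 :=
    measureReal_le_one
  linarith

/-! ### Gaps in the stochastically constrained regime -/

theorem measurable_loss_sub (hℓ : IsLossProcess ℓ) {t : ℕ} (ht : 1 ≤ t) (i j : Fin K) (d : ℝ) :
    Measurable fun ω => ℓ t ω i - ℓ t ω j - d :=
  (((measurable_pi_apply i).comp (hℓ.measurable t ht)).sub
    ((measurable_pi_apply j).comp (hℓ.measurable t ht))).sub_const d

theorem abs_loss_sub_le (hℓ : IsLossProcess ℓ) {t : ℕ} (ht : 1 ≤ t) (i j : Fin K) (d : ℝ) (ω : Ω) :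
    |ℓ t ω i - ℓ t ω j - d| ≤ 1 + |d| := by
  have h1 := hℓ.mem_Icc t ht ω i
  have h2 := hℓ.mem_Icc t ht ω j
  refine (abs_sub _ _).trans (add_le_add (abs_le.2 ⟨?_, ?_⟩) le_rfl) <;>
    linarith [h1.1, h1.2, h2.1, h2.2]

theorem integral_pastLosses_mul_gap [IsProbabilityMeasure μ] (hℓ : IsLossProcess ℓ)
    {Δ : Fin K → Fin K → ℝ} (hΔ : IsStochasticallyConstrained μ ℓ Δ) {t : ℕ} (ht : 1 ≤ t)
    (i j : Fin K) {X : Ω → ℝ} (hX : Measurable[pastLosses ℓ t] X) {M : ℝ} (hM : ∀ ω, |X ω| ≤ M) :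
    ∫ ω, X ω * (ℓ t ω i - ℓ t ω j - Δ i j) ∂μ = 0 := by
  have hm : pastLosses ℓ t ≤ ‹MeasurableSpace Ω› :=
    iSup₂_le fun s hs => (hℓ.measurable s (Finset.mem_Ico.1 hs).1).comap_le
  have hD : Integrable (fun ω => ℓ t ω i - ℓ t ω j) μ := by
    have h1 := measurable_loss_sub hℓ ht i j 0
    have h2 := abs_loss_sub_le hℓ ht i j 0
    simp only [sub_zero] at h1 h2
    exact integrable_of_abs_le h1 h2
  have h1 := condExp_stronglyMeasurable_mul_of_bound hm (μ := μ) hX.stronglyMeasurable hD M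
    (ae_of_all _ hM)
  have hXD : Integrable (fun ω => X ω * (ℓ t ω i - ℓ t ω j)) μ :=
    hD.bdd_mul (hX.mono hm le_rfl).aestronglyMeasurable (ae_of_all _ hM)
  have hXI : Integrable (fun ω => X ω * Δ i j) μ :=
    (integrable_of_abs_le (hX.mono hm le_rfl) hM).mul_const _
  have h2 : ∫ ω, X ω * (ℓ t ω i - ℓ t ω j) ∂μ = ∫ ω, X ω * Δ i j ∂μ := by
    calc ∫ ω, X ω * (ℓ t ω i - ℓ t ω j) ∂μ
        = ∫ ω, (μ[X * fun ω => ℓ t ω i - ℓ t ω j | pastLosses ℓ t]) ω ∂μ :=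
          (integral_condExp hm).symm
      _ = _ := by
          refine integral_congr_ae ?_
          filter_upwards [h1, hΔ t ht i j] with ω h3 h4
          rw [h3, Pi.mul_apply, h4]
  simp only [mul_sub (X _) (_ - _)]
  rw [integral_sub hXD hXI, h2, sub_self]

/-- The draws of earlier blocks carry no information on the gap between two arms. -/
theorem integral_path_mul_gap [NeZero K] [IsProbabilityMeasure μ] (hη : ∀ n, 0 < η (n + 1))
    (hℓ : IsLossProcess ℓ) (hI : IsTsallisSwitchRun μ η len ℓ I) {Δ : Fin K → Fin K → ℝ}
    (hΔ : IsStochasticallyConstrained μ ℓ Δ) {t : ℕ} (ht : 1 ≤ t) (i j : Fin K) (s : ℕ → Fin K)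
    (m : ℕ) (hm : blockEnd len m < t) {X : Ω → ℝ} (hX : Measurable[pastLosses ℓ t] X) {M : ℝ}
    (hM : ∀ ω, |X ω| ≤ M) :
    ∫ ω, (if ∀ k ∈ Finset.Icc 1 m, I k ω = s k then X ω * (ℓ t ω i - ℓ t ω j - Δ i j) else 0) ∂μ
      = 0 := by
  -- Draws are peeled off from the last one. Each is replaced by its probability given the whole
  -- loss sequence and the earlier draws, and this factor is absorbed into X.
  induction m generalizing X with
  | zero => simpa using integral_pastLosses_mul_gap hℓ hΔ ht i j hX hM
  | succ m ih =>
    have hm' : blockEnd len m < t := (blockEnd_mono len m.le_succ).trans_lt hm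
    set Z : Ω → ℝ := fun ω =>
      if ∀ k ∈ Finset.Icc 1 m, I k ω = s k then X ω * (ℓ t ω i - ℓ t ω j - Δ i j) else 0 with hZ
    have hM0 : 0 ≤ M := by
      obtain ⟨ω⟩ := μ.nonempty_of_neZero
      exact (abs_nonneg _).trans (hM ω)
    have hZm : Measurable[drawInfo ℓ I (m + 1)] Z := by
      refine Measurable.ite ?_ ?_ measurable_const
      · have : {ω | ∀ k ∈ Finset.Icc 1 m, I k ω = s k} =
            ⋂ k ∈ Finset.Icc 1 m, I k ⁻¹' {s k} := by
          ext ω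
          simp
        rw [this]
        refine Finset.measurableSet_biInter _ fun k hk => ?_
        have hk := Finset.mem_Icc.1 hk
        exact measurable_draw_drawInfo ℓ I hk.1 (by omega) (measurableSet_singleton _)
      · have hl := measurable_loss_drawInfo ℓ I (m + 1) ht
        exact (hX.mono (pastLosses_le_drawInfo ℓ I t _) le_rfl).mul
          ((((measurable_pi_apply i).comp hl).sub ((measurable_pi_apply j).comp hl)).sub_const _)
    have hZb : ∀ ω, |Z ω| ≤ M * (1 + |Δ i j|) := fun ω => by
      simp only [hZ]
      split_ifs
      · rw [abs_mul]
        exact mul_le_mul (hM ω) (abs_loss_sub_le hℓ ht i j _ ω) (abs_nonneg _) hM0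
      · simpa using by positivity
    have h1 := integral_ite_draw_eq hℓ hI (n := m + 1) (by omega) (s (m + 1)) hZm hZb
    -- Along the frozen path s the sampling probability depends only on losses of the first m
    -- blocks, all before round t.
    have hX' : Measurable[pastLosses ℓ t] fun ω =>
        samplingDist η len (fun t => ℓ t ω) s (m + 1) (s (m + 1)) * X ω := by
      refine Measurable.mul ((measurable_pi_apply _).comp ?_) hX
      exact measurable_samplingDist hη (I := fun k _ => s k)
        (fun r hr1 hr2 => measurable_loss_pastLosses ℓ hr1 (by omega)) fun _ _ _ => measurable_const
    have hXb : ∀ ω, |samplingDist η len (fun t => ℓ t ω) s (m + 1) (s (m + 1)) * X ω| ≤ M :=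
      fun ω => by
        rw [abs_mul, abs_of_nonneg (samplingDist_pos hη len _ _ m _).le]
        exact (mul_le_of_le_one_left (abs_nonneg _) (samplingDist_le_one _ _ _ _ _ _)).trans (hM ω)
    refine Eq.trans ?_ (ih hm' hX' hXb)
    calc _ = ∫ ω, (if I (m + 1) ω = s (m + 1) then Z ω else 0) ∂μ := by
          refine integral_congr_ae (ae_of_all _ fun ω => ?_)
          have : (∀ k ∈ Finset.Icc 1 (m + 1), I k ω = s k) ↔
              I (m + 1) ω = s (m + 1) ∧ ∀ k ∈ Finset.Icc 1 m, I k ω = s k := by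
            rw [← Finset.insert_Icc_right_eq_Icc_add_one (by omega), Finset.forall_mem_insert]
          simp only [this, hZ, ite_and]
      _ = _ := h1
      _ = _ := by
          refine integral_congr_ae (ae_of_all _ fun ω => ?_)
          simp only [hZ, mul_ite, mul_zero]
          refine if_ctx_congr Iff.rfl (fun h => ?_) fun _ => rfl
          have h2 : samplingDist η len (fun t => ℓ t ω) (fun k => I k ω) (m + 1) =
              samplingDist η len (fun t => ℓ t ω) s (m + 1) := by
            unfold samplingDist
            rw [Nat.add_sub_cancel, cumEstimate_congr η (fun _ _ _ => rfl)
              fun k h1 h2 => h k (Finset.mem_Icc.2 ⟨h1, h2⟩)]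
          rw [h2]
          ring

/-- Only finitely many paths of n draws exist. On each of them the sampling probability is a
function of the past losses, so `integral_path_mul_gap` applies path by path. -/
theorem integral_samplingDist_mul_gap [NeZero K] [IsProbabilityMeasure μ]
    (hη : ∀ n, 0 < η (n + 1)) (hℓ : IsLossProcess ℓ) (hI : IsTsallisSwitchRun μ η len ℓ I)
    {Δ : Fin K → Fin K → ℝ} (hΔ : IsStochasticallyConstrained μ ℓ Δ) {t : ℕ} (ht : 1 ≤ t)
    (i j : Fin K) (n : ℕ) (hn : blockEnd len n < t) :
    ∫ ω, samplingDist η len (fun t => ℓ t ω) (fun k => I k ω) (n + 1) i *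
      (ℓ t ω i - ℓ t ω j - Δ i j) ∂μ = 0 := by
  -- Draws are numbered from 1, coordinates of σ from 0.
  let ext (σ : Fin n → Fin K) (k : ℕ) : Fin K := if h : k - 1 < n then σ ⟨k - 1, h⟩ else 0
  have hext : ∀ (σ : Fin n → Fin K) ω,
      (∀ k ∈ Finset.Icc 1 n, I k ω = ext σ k) ↔ σ = fun k : Fin n => I (k + 1) ω := by
    intro σ ω
    constructor
    · intro h
      funext k
      have h1 := h (k + 1) (Finset.mem_Icc.2 ⟨by omega, by omega⟩)
      simp only [ext, Nat.add_sub_cancel, k.2, dif_pos] at h1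
      exact h1.symm
    · rintro rfl k hk
      have hk := Finset.mem_Icc.1 hk
      simp only [ext, show k - 1 < n by omega, dif_pos]
      rw [Nat.sub_add_cancel hk.1]
  have hX : ∀ σ, Measurable[pastLosses ℓ t] fun ω =>
      samplingDist η len (fun t => ℓ t ω) (ext σ) (n + 1) i := fun σ =>
    (measurable_pi_apply _).comp (measurable_samplingDist hη (I := fun k _ => ext σ k)
      (fun r hr1 hr2 => measurable_loss_pastLosses ℓ hr1 (by omega)) fun _ _ _ => measurable_const)
  have hXb : ∀ σ ω, |samplingDist η len (fun t => ℓ t ω) (ext σ) (n + 1) i| ≤ 1 := fun σ ω => by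
    rw [abs_of_nonneg (samplingDist_pos hη len _ _ n _).le]
    exact samplingDist_le_one _ _ _ _ _ _
  have hsum : (fun ω => samplingDist η len (fun t => ℓ t ω) (fun k => I k ω) (n + 1) i *
      (ℓ t ω i - ℓ t ω j - Δ i j)) = fun ω => ∑ σ, if ∀ k ∈ Finset.Icc 1 n, I k ω = ext σ k then
        samplingDist η len (fun t => ℓ t ω) (ext σ) (n + 1) i * (ℓ t ω i - ℓ t ω j - Δ i j)
        else 0 := by
    funext ω
    simp only [hext, Finset.sum_ite_eq', Finset.mem_univ, if_true]
    have h2 : samplingDist η len (fun t => ℓ t ω) (fun k => I k ω) (n + 1) =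
        samplingDist η len (fun t => ℓ t ω) (ext fun k : Fin n => I (k + 1) ω) (n + 1) := by
      unfold samplingDist
      rw [Nat.add_sub_cancel, cumEstimate_congr η (fun _ _ _ => rfl)
        fun k h1 h2 => (hext _ ω).2 rfl k (Finset.mem_Icc.2 ⟨h1, h2⟩)]
    rw [h2]
  rw [hsum, integral_finsetSum]
  · exact Finset.sum_eq_zero fun σ _ =>
      integral_path_mul_gap hη hℓ hI hΔ ht i j (ext σ) n hn (hX σ) (hXb σ)
  · intro σ _
    refine integrable_of_abs_le (M := 1 * (1 + |Δ i j|)) (Measurable.ite ?_ ?_ measurable_const)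
      fun ω => ?_
    · have : {ω | ∀ k ∈ Finset.Icc 1 n, I k ω = ext σ k} =
          ⋂ k ∈ Finset.Icc 1 n, I k ⁻¹' {ext σ k} := by
        ext ω
        simp
      rw [this]
      refine Finset.measurableSet_biInter _ fun k hk => ?_
      exact hI.measurable k (Finset.mem_Icc.1 hk).1 (measurableSet_singleton _)
    · have hm : pastLosses ℓ t ≤ ‹MeasurableSpace Ω› :=
        iSup₂_le fun s hs => (hℓ.measurable s (Finset.mem_Ico.1 hs).1).comap_le
      exact ((hX σ).mono hm le_rfl).mul (measurable_loss_sub hℓ ht i j _)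
    · split_ifs
      · rw [abs_mul]
        exact mul_le_mul (hXb σ ω) (abs_loss_sub_le hℓ ht i j _ ω) (abs_nonneg _) zero_le_one
      · simpa using by positivity

/-- The expected regret of a round against arm `j`. -/
theorem integral_loss_draw_sub [NeZero K] [IsProbabilityMeasure μ]
    (hη : ∀ n, 0 < η (n + 1)) (hℓ : IsLossProcess ℓ) (hI : IsTsallisSwitchRun μ η len ℓ I)
    {Δ : Fin K → Fin K → ℝ} (hΔ : IsStochasticallyConstrained μ ℓ Δ) (j : Fin K) {n t : ℕ}
    (ht : t ∈ block len (n + 1)) :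
    ∫ ω, (ℓ t ω (I (n + 1) ω) - ℓ t ω j) ∂μ = ∫ ω, ∑ i,
      samplingDist η len (fun t => ℓ t ω) (fun k => I k ω) (n + 1) i * Δ i j ∂μ := by
  have ht1 := one_le_of_mem_block ht
  have hl := measurable_loss_drawInfo ℓ I (n + 1) ht1
  have hpm : ∀ i, Measurable fun ω =>
      samplingDist η len (fun t => ℓ t ω) (fun k => I k ω) (n + 1) i := fun i =>
    (measurable_pi_apply i).comp
      ((measurable_samplingDist_drawInfo hη len ℓ I n).mono (drawInfo_le hℓ hI _) le_rfl)
  have hpb : ∀ i ω, |samplingDist η len (fun t => ℓ t ω) (fun k => I k ω) (n + 1) i| ≤ 1 :=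
    fun i ω => by
      rw [abs_of_nonneg (samplingDist_pos hη len _ _ n _).le]
      exact samplingDist_le_one _ _ _ _ _ _
  have hpI := fun i => integrable_of_abs_le (μ := μ) (hpm i) (hpb i)
  have hDb : ∀ i ω, |ℓ t ω i - ℓ t ω j| ≤ 1 := fun i ω => by
    simpa using abs_loss_sub_le hℓ ht1 i j 0 ω
  have hDm : ∀ i, Measurable fun ω => ℓ t ω i - ℓ t ω j := fun i => by
    simpa using measurable_loss_sub hℓ ht1 i j 0
  rw [integral_apply_draw_eq hη hℓ hI n (Z := fun i ω => ℓ t ω i - ℓ t ω j) (M := 1)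
    (fun i => ((measurable_pi_apply i).comp hl).sub ((measurable_pi_apply j).comp hl)) hDb,
    integral_finsetSum, integral_finsetSum]
  · refine Finset.sum_congr rfl fun i _ => ?_
    have h := integral_samplingDist_mul_gap hη hℓ hI hΔ ht1 i j n (Finset.mem_Ioc.1 ht).1
    simp only [mul_sub _ (_ - _) (Δ i j)] at h
    rw [integral_sub ((hpI i).mul_bdd (hDm i).aestronglyMeasurable (ae_of_all _ (hDb i)))
      ((hpI i).mul_const _)] at h
    linarith
  · exact fun i _ => (hpI i).mul_const _
  · exact fun i _ => (hpI i).mul_bdd (hDm i).aestronglyMeasurable (ae_of_all _ (hDb i))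

end Prob

end

section

variable {K : ℕ} {Ω : Type*}

/-! ### The tuned parameters -/

/-- The coefficient of `√n` in `aParam`. -/
def aCoeff (lam : ℝ) (K : ℕ) : ℝ := 3 * lam / (2 * √(K : ℝ))

theorem aCoeff_nonneg {lam : ℝ} (hlam : 0 ≤ lam) (K : ℕ) : 0 ≤ aCoeff lam K := by
  unfold aCoeff
  positivity

theorem sqrt_natCast_pos [NeZero K] : 0 < √(K : ℝ) :=
  Real.sqrt_pos.2 (by exact_mod_cast NeZero.pos K)

theorem aCoeff_mul_sqrt [NeZero K] (lam : ℝ) : aCoeff lam K * √(K : ℝ) = 3 * lam / 2 := by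
  have := sqrt_natCast_pos (K := K)
  unfold aCoeff
  field_simp

theorem aParam_eq (lam : ℝ) (K n : ℕ) : aParam lam K n = aCoeff lam K * √(n : ℝ) := by
  rw [aParam, aCoeff, Real.sqrt_div (Nat.cast_nonneg n)]
  ring

theorem sqrt_succ_pos (n : ℕ) : 0 < √((n + 1 : ℕ) : ℝ) := Real.sqrt_pos.2 (by positivity)

theorem learningRate_pos {lam : ℝ} (hlam : 0 ≤ lam) (K n : ℕ) :
    0 < learningRate lam K (n + 1) := by
  have h1 := aCoeff_nonneg hlam K
  have h2 : 0 < √(2 / ((n + 1 : ℕ) : ℝ)) := Real.sqrt_pos.2 (by positivity)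
  rw [learningRate, aParam_eq]
  positivity

/-- The inverse learning rate, set to `0` at `0`. -/
def invRate (lam : ℝ) (K n : ℕ) : ℝ := (aCoeff lam K * n + √(n : ℝ)) / (2 * √2)

theorem invRate_zero (lam : ℝ) (K : ℕ) : invRate lam K 0 = 0 := by simp [invRate]

theorem invRate_succ {lam : ℝ} (hlam : 0 ≤ lam) (K n : ℕ) :
    invRate lam K (n + 1) = (learningRate lam K (n + 1))⁻¹ := by
  have h1 := aCoeff_nonneg hlam K
  have h2 := sqrt_succ_pos n
  have h3 : ((n + 1 : ℕ) : ℝ) = √((n + 1 : ℕ) : ℝ) ^ 2 := (Real.sq_sqrt (by positivity)).symm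
  rw [invRate, learningRate, aParam_eq, Real.sqrt_div (by norm_num)]
  conv_lhs => rw [h3, Real.sqrt_sq h2.le]
  have h4 : 0 < aCoeff lam K * √((n + 1 : ℕ) : ℝ) + 1 := by positivity
  field_simp

/-- The order of the regret incurred in block `n + 1` per unit of exploration. -/
def blockRate (lam : ℝ) (K n : ℕ) : ℝ := aCoeff lam K + 1 / √((n + 1 : ℕ) : ℝ)

theorem blockRate_nonneg {lam : ℝ} (hlam : 0 ≤ lam) (K n : ℕ) : 0 ≤ blockRate lam K n := by
  have h1 := aCoeff_nonneg hlam K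
  unfold blockRate
  positivity

theorem blockRate_eq (lam : ℝ) (K n : ℕ) :
    blockRate lam K n = (aParam lam K (n + 1) + 1) / √((n + 1 : ℕ) : ℝ) := by
  have h2 := sqrt_succ_pos n
  rw [blockRate, aParam_eq]
  field_simp

theorem one_le_blockLen (lam : ℝ) (K n : ℕ) : 1 ≤ blockLen lam K n := le_max_right _ _

theorem aParam_nonneg {lam : ℝ} (hlam : 0 ≤ lam) (K n : ℕ) : 0 ≤ aParam lam K n := by
  unfold aParam
  positivity

theorem aParam_le_blockLen (lam : ℝ) (K n : ℕ) : aParam lam K n ≤ blockLen lam K n :=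
  (Nat.le_ceil _).trans (by exact_mod_cast le_max_left _ _)

theorem blockLen_le {lam : ℝ} (hlam : 0 ≤ lam) (K n : ℕ) :
    (blockLen lam K n : ℝ) ≤ aParam lam K n + 1 := by
  have h := aParam_nonneg hlam K n
  rw [blockLen, Nat.cast_max]
  exact max_le (Nat.ceil_lt_add_one h).le (by simpa using h)

theorem learningRate_mul_blockLen_le {lam : ℝ} (hlam : 0 ≤ lam) (K n : ℕ) :
    learningRate lam K (n + 1) * blockLen lam K (n + 1) ≤ 2 * √2 / √((n + 1 : ℕ) : ℝ) := by
  have h1 := aParam_nonneg hlam K (n + 1)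
  have h2 := sqrt_succ_pos n
  calc learningRate lam K (n + 1) * blockLen lam K (n + 1)
      ≤ learningRate lam K (n + 1) * (aParam lam K (n + 1) + 1) :=
        mul_le_mul_of_nonneg_left (blockLen_le hlam K _) (learningRate_pos hlam K n).le
    _ = _ := by
        rw [learningRate, Real.sqrt_div (by norm_num)]
        field_simp

/-- Because `len` ≤ a_n + 1, the factor 2/(a_n + 1) in the learning rate cancels one of the two
block lengths. -/
theorem half_learningRate_mul_sq_le {lam : ℝ} (hlam : 0 ≤ lam) (K n : ℕ) :
    learningRate lam K (n + 1) / 2 * (blockLen lam K (n + 1) : ℝ) ^ 2 ≤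
      √2 * blockRate lam K n := by
  have h1 := aParam_nonneg hlam K (n + 1)
  have h2 := sqrt_succ_pos n
  calc learningRate lam K (n + 1) / 2 * (blockLen lam K (n + 1) : ℝ) ^ 2
      = learningRate lam K (n + 1) * blockLen lam K (n + 1) * blockLen lam K (n + 1) / 2 := by ring
    _ ≤ 2 * √2 / √((n + 1 : ℕ) : ℝ) * (aParam lam K (n + 1) + 1) / 2 := by
        gcongr
        · exact learningRate_mul_blockLen_le hlam K n
        · exact blockLen_le hlam K _
    _ = _ := by
        rw [blockRate_eq]
        field_simp

theorem sqrt_succ_sub_sqrt_mem (n : ℕ) :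
    √((n + 1 : ℕ) : ℝ) - √(n : ℝ) ∈ Set.Icc 0 (1 / √((n + 1 : ℕ) : ℝ)) := by
  have h2 := sqrt_succ_pos n
  have h3 : √(n : ℝ) ≤ √((n + 1 : ℕ) : ℝ) := Real.sqrt_le_sqrt (by push_cast; linarith)
  refine ⟨by linarith, ?_⟩
  rw [le_div_iff₀ h2]
  have h4 := Real.sq_sqrt (Nat.cast_nonneg (α := ℝ) (n + 1))
  have h5 := Real.sq_sqrt (Nat.cast_nonneg (α := ℝ) n)
  push_cast at h4 h5 h3 ⊢
  nlinarith [Real.sqrt_nonneg (n : ℝ)]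

theorem invRate_sub_mem {lam : ℝ} (hlam : 0 ≤ lam) (K n : ℕ) :
    invRate lam K (n + 1) - invRate lam K n ∈ Set.Icc 0 (blockRate lam K n / (2 * √2)) := by
  have h1 := aCoeff_nonneg hlam K
  have h2 := sqrt_succ_sub_sqrt_mem n
  have h3 : invRate lam K (n + 1) - invRate lam K n =
      (aCoeff lam K + (√((n + 1 : ℕ) : ℝ) - √(n : ℝ))) / (2 * √2) := by
    simp only [invRate]
    push_cast
    ring
  rw [h3]
  constructor
  · have := h2.1
    positivity
  · unfold blockRate
    gcongr
    exact h2.2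

/-- The penalty of one step, when the penalty term is bounded by `s`. -/
theorem penalty_le {lam : ℝ} (hlam : 0 ≤ lam) (K n : ℕ) {x s : ℝ} (hx : x ≤ s) (hs : 0 ≤ s) :
    (invRate lam K (n + 1) - invRate lam K n) * (4 * x) ≤ √2 * blockRate lam K n * s := by
  have h1 := invRate_sub_mem hlam K n
  calc (invRate lam K (n + 1) - invRate lam K n) * (4 * x)
      ≤ (invRate lam K (n + 1) - invRate lam K n) * (4 * s) := by
        have := h1.1
        gcongr
    _ ≤ blockRate lam K n / (2 * √2) * (4 * s) := by
        have := h1.2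
        gcongr
    _ = _ := by
        field_simp
        rw [Real.sq_sqrt (by norm_num)]
        ring

/-- This is (a + 1)² ≤ L (1 + 3a), which holds for every L ≥ max(a, 1). The two terms yield the
logarithm and the T^(1/3) rate. -/
theorem sq_blockRate_div_le {lam : ℝ} (hlam : 0 ≤ lam) (K n : ℕ) :
    blockRate lam K n ^ 2 / blockLen lam K (n + 1) ≤
      1 / ((n + 1 : ℕ) : ℝ) + 3 * aCoeff lam K / √((n + 1 : ℕ) : ℝ) := by
  have h2 := sqrt_succ_pos n
  have h3 : ((n + 1 : ℕ) : ℝ) = √((n + 1 : ℕ) : ℝ) ^ 2 := (Real.sq_sqrt (by positivity)).symm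
  have ha := aParam_nonneg hlam K (n + 1)
  have hL1 : (1 : ℝ) ≤ blockLen lam K (n + 1) := by exact_mod_cast one_le_blockLen lam K (n + 1)
  have hLa := aParam_le_blockLen lam K (n + 1)
  have h4 : 1 / ((n + 1 : ℕ) : ℝ) + 3 * aCoeff lam K / √((n + 1 : ℕ) : ℝ) =
      (1 + 3 * aParam lam K (n + 1)) / ((n + 1 : ℕ) : ℝ) := by
    rw [aParam_eq]
    conv_rhs => rw [h3, Real.sqrt_sq h2.le]
    conv_lhs => rw [h3, Real.sqrt_sq h2.le]
    field_simp
  rw [h4, blockRate_eq, div_pow, Real.sq_sqrt (Nat.cast_nonneg _), div_right_comm]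
  gcongr
  rw [div_le_iff₀ (by linarith)]
  set a := aParam lam K (n + 1)
  set L := (blockLen lam K (n + 1) : ℝ)
  rcases le_total a 1 with h | h
  · nlinarith
  · nlinarith

theorem sq_div_blockLen_le [NeZero K] {lam : ℝ} (hlam : 0 ≤ lam) (n : ℕ) :
    3 * (lam ^ 2 / blockLen lam K (n + 1)) ≤ 2 * (lam * √(K : ℝ)) / √((n + 1 : ℕ) : ℝ) := by
  have h2 := sqrt_succ_pos n
  have hK := sqrt_natCast_pos (K := K)
  have hL1 : (1 : ℝ) ≤ blockLen lam K (n + 1) := by exact_mod_cast one_le_blockLen lam K (n + 1)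
  have hLa := aParam_le_blockLen lam K (n + 1)
  rw [aParam_eq, aCoeff, div_mul_eq_mul_div, div_le_iff₀ (by positivity)] at hLa
  rw [← mul_div_assoc, div_le_div_iff₀ (by linarith) h2]
  nlinarith

/-! ### Numerical sums -/

theorem sum_one_div_sqrt_le (N : ℕ) :
    ∑ n ∈ Finset.range N, 1 / √((n + 1 : ℕ) : ℝ) ≤ 2 * √(N : ℝ) := by
  induction N with
  | zero => simp
  | succ N ih =>
    rw [Finset.sum_range_succ]
    have h2 := sqrt_succ_pos N
    have h3 : 1 / √((N + 1 : ℕ) : ℝ) ≤ 2 * (√((N + 1 : ℕ) : ℝ) - √(N : ℝ)) := by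
      rw [div_le_iff₀ h2]
      have h4 := Real.sq_sqrt (Nat.cast_nonneg (α := ℝ) (N + 1))
      have h5 := Real.sq_sqrt (Nat.cast_nonneg (α := ℝ) N)
      push_cast at h4 h5 ⊢
      nlinarith [sq_nonneg (√((N : ℝ) + 1) - √(N : ℝ))]
    linarith

/-- A discrete form of ∫ √x dx = (2/3) N^(3/2). With u = √(N+1) and v = √N, the induction step is (u
- v)² (u + 2v) ≥ 0. -/
theorem two_mul_mul_sqrt_le_sum (N : ℕ) :
    2 * (N * √(N : ℝ)) ≤ 3 * ∑ n ∈ Finset.range N, √((n + 1 : ℕ) : ℝ) := by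
  induction N with
  | zero => simp
  | succ N ih =>
    rw [Finset.sum_range_succ]
    have h2 := (sqrt_succ_pos N).le
    have h3 := Real.sqrt_nonneg (N : ℝ)
    have h4 := Real.sq_sqrt (Nat.cast_nonneg (α := ℝ) (N + 1))
    have h5 := Real.sq_sqrt (Nat.cast_nonneg (α := ℝ) N)
    set u := √((N + 1 : ℕ) : ℝ)
    set v := √(N : ℝ)
    have h6 : 0 ≤ (u - v) ^ 2 * (u + 2 * v) := by positivity
    have h7 : u ^ 2 = v ^ 2 + 1 := by rw [h4, h5]; push_cast; ring
    have h8 : (u - v) ^ 2 * (u + 2 * v) = u * u ^ 2 - 3 * u * v ^ 2 + 2 * v * v ^ 2 := by ring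
    rw [h8, h7] at h6
    rw [← h5] at ih
    rw [← h4, h7]
    linarith

/-! ### The number of blocks in terms of the horizon. -/

theorem blockEnd_eq_sum_range (len : ℕ → ℕ) (N : ℕ) :
    blockEnd len N = ∑ n ∈ Finset.range N, len (n + 1) := by
  induction N with
  | zero => simp [blockEnd]
  | succ N ih => rw [blockEnd_succ, Finset.sum_range_succ, ih]

theorem lam_mul_le_of_blockEnd_le [NeZero K] {lam : ℝ} (hlam : 0 ≤ lam) {N T : ℕ}
    (hN : blockEnd (blockLen lam K) N ≤ T) : lam * (N * √(N : ℝ)) ≤ √(K : ℝ) * T := by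
  have hK := sqrt_natCast_pos (K := K)
  have h1 : aCoeff lam K * ∑ n ∈ Finset.range N, √((n + 1 : ℕ) : ℝ) ≤ T := by
    refine le_trans ?_ (Nat.cast_le.2 hN)
    rw [blockEnd_eq_sum_range, Nat.cast_sum, Finset.mul_sum]
    exact Finset.sum_le_sum fun n _ => (aParam_eq lam K (n + 1)).symm.trans_le
      (aParam_le_blockLen lam K (n + 1))
  have h2 := mul_le_mul_of_nonneg_left (two_mul_mul_sqrt_le_sum N) (aCoeff_nonneg hlam K)
  have h3 : aCoeff lam K * (2 * (N * √(N : ℝ))) ≤ 3 * T := by linarith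
  have h4 := mul_le_mul_of_nonneg_right h3 hK.le
  have h5 := aCoeff_mul_sqrt (K := K) lam
  have h6 : aCoeff lam K * (2 * (N * √(N : ℝ))) * √(K : ℝ) = 3 * lam / 2 * (2 * (N * √(N : ℝ))) := by
    rw [← h5]; ring
  rw [h6] at h4
  linarith

theorem le_rpow_of_cube_le {x y : ℝ} (hy : 0 ≤ y) (h : x ^ 3 ≤ y) : x ≤ y ^ (1 / 3 : ℝ) := by
  refine le_of_pow_le_pow_left₀ (n := 3) (by norm_num) (by positivity) ?_
  rwa [← Real.rpow_natCast (y ^ (1 / 3 : ℝ)), ← Real.rpow_mul hy, show (1 / 3 : ℝ) * (3 : ℕ) = 1 by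
    norm_num, Real.rpow_one]

theorem lam_mul_blocks_le [NeZero K] {lam : ℝ} (hlam : 0 ≤ lam) {N T : ℕ}
    (hN : blockEnd (blockLen lam K) N ≤ T) :
    lam * N ≤ (lam * K) ^ (1 / 3 : ℝ) * (T : ℝ) ^ (2 / 3 : ℝ) := by
  have h := lam_mul_le_of_blockEnd_le hlam hN
  have h1 : (lam * (N * √(N : ℝ))) ^ 2 ≤ (√(K : ℝ) * T) ^ 2 := by gcongr
  rw [mul_pow √(K : ℝ), Real.sq_sqrt (Nat.cast_nonneg _), mul_pow, mul_pow,
    Real.sq_sqrt (Nat.cast_nonneg _)] at h1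
  -- The cube is λ (λ N^(3/2))², and λ N^(3/2) ≤ √K T.
  have h2 : (lam * N) ^ 3 ≤ lam * K * T ^ 2 := by
    have := mul_le_mul_of_nonneg_left h1 hlam
    nlinarith
  refine (le_rpow_of_cube_le (by positivity) h2).trans_eq ?_
  rw [Real.mul_rpow (by positivity) (by positivity), ← Real.rpow_natCast (T : ℝ),
    ← Real.rpow_mul (Nat.cast_nonneg _)]
  norm_num

theorem lam_mul_sqrt_blocks_le [NeZero K] {lam : ℝ} (hlam : 0 ≤ lam) {N T : ℕ}
    (hN : blockEnd (blockLen lam K) N ≤ T) :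
    lam * √(K : ℝ) * √(N : ℝ) ≤ (lam * K) ^ (2 / 3 : ℝ) * (T : ℝ) ^ (1 / 3 : ℝ) := by
  have h := lam_mul_le_of_blockEnd_le hlam hN
  have h2 : (lam * √(K : ℝ) * √(N : ℝ)) ^ 3 ≤ (lam * K) ^ 2 * T := by
    have hK := Real.sq_sqrt (Nat.cast_nonneg (α := ℝ) K)
    have hN := Real.sq_sqrt (Nat.cast_nonneg (α := ℝ) N)
    have h3 : 0 ≤ lam ^ 2 * (√(K : ℝ) ^ 2 * √(K : ℝ)) := by positivity
    calc (lam * √(K : ℝ) * √(N : ℝ)) ^ 3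
        = lam ^ 2 * (√(K : ℝ) ^ 2 * √(K : ℝ)) * (lam * (√(N : ℝ) ^ 2 * √(N : ℝ))) := by ring
      _ ≤ lam ^ 2 * (√(K : ℝ) ^ 2 * √(K : ℝ)) * (√(K : ℝ) * T) := by
          rw [hN]
          gcongr
      _ = lam ^ 2 * (√(K : ℝ) ^ 2) ^ 2 * T := by ring
      _ = _ := by rw [hK]; ring
  refine (le_rpow_of_cube_le (by positivity) h2).trans_eq ?_
  rw [Real.mul_rpow (by positivity) (by positivity), ← Real.rpow_natCast (lam * K),
    ← Real.rpow_mul (by positivity)]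
  norm_num

theorem sum_sqrt_le [NeZero K] {p : Fin K → ℝ} (hp : p ∈ stdSimplex ℝ (Fin K)) :
    ∑ i, √(p i) ≤ √(K : ℝ) := by
  refine Real.le_sqrt_of_sq_le ?_
  have h := sq_sum_le_card_mul_sum_sq (s := Finset.univ) (f := fun i => √(p i))
  simp only [Real.sq_sqrt (hp.1 _), hp.2, Finset.card_univ, Fintype.card_fin, mul_one] at h
  exact h

end

section

variable {K : ℕ} {Ω : Type*}

section Regret

variable [MeasurableSpace Ω] {μ : Measure Ω} {η : ℕ → ℝ} {len : ℕ → ℕ}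
  {ℓ : ℕ → Ω → Fin K → ℝ} {I : ℕ → Ω → Fin K}

/-! ### From expected regret to pseudo-regret -/

theorem integrable_comp_samplingDist [NeZero K] [IsProbabilityMeasure μ] (hη : ∀ n, 0 < η (n + 1))
    (hℓ : IsLossProcess ℓ) (hI : IsTsallisSwitchRun μ η len ℓ I) (n : ℕ) {f : (Fin K → ℝ) → ℝ}
    (hf : Continuous f) : Integrable
      (fun ω => f (samplingDist η len (fun t => ℓ t ω) (fun k => I k ω) (n + 1))) μ := by
  obtain ⟨M, hM⟩ := (isCompact_stdSimplex ℝ (Fin K)).exists_bound_of_continuousOn hf.continuousOn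
  exact integrable_of_abs_le (hf.measurable.comp ((measurable_samplingDist_drawInfo hη len ℓ I
    n).mono (drawInfo_le hℓ hI _) le_rfl)) fun ω => hM _ (samplingDist_mem _ _ _ _ _)

/-- Averaging over the draw multiplies the stability bound by p_i, which removes its singularity.
The sum is therefore dominated by a continuous H, bounded on the compact simplex. -/
theorem expected_regret_le_of_continuous [NeZero K] [IsProbabilityMeasure μ]
    (hη : ∀ n, 0 < η (n + 1)) (hlen : ∀ n, 1 ≤ len n) {ρ : ℕ → ℝ} (h0 : ρ 0 = 0)
    (hρ : ∀ n, ρ (n + 1) = (η (n + 1))⁻¹) (hℓ : IsLossProcess ℓ)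
    (hI : IsTsallisSwitchRun μ η len ℓ I) {T N : ℕ} (hN : blockEnd len N ≤ T)
    (hT : T ≤ blockEnd len (N + 1)) (j : Fin K) (g : ℕ → Fin K → (Fin K → ℝ) → ℝ)
    (hgm : ∀ n i, Measurable (g n i))
    (hgb : ∀ n (ε : ℝ), 0 < ε → ∃ M : ℝ, ∀ i, ∀ p ∈ stdSimplex ℝ (Fin K), (∀ k, ε ≤ p k) →
      |g n i p| ≤ M)
    (hg : ∀ n C i c, 0 ≤ c → c ≤ (len (n + 1) : ℝ) →
      stepStability (η (n + 1)) C i c ≤ g n i (tsallisArgmin (η (n + 1)) C))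
    {H : ℕ → (Fin K → ℝ) → ℝ} (hH : ∀ n, Continuous (H n))
    (hle : ∀ n, ∀ p ∈ stdSimplex ℝ (Fin K), (∀ k, 0 < p k) →
      ∑ i, p i * g n i p + (ρ (n + 1) - ρ n) * (4 * (∑ i, √(p i) - 1)) ≤ H n p) :
    (∫ ω, ∑ t ∈ Finset.Icc 1 T, ℓ t ω (I (blockIndex len t) ω) ∂μ)
        - ∫ ω, ∑ t ∈ Finset.Icc 1 T, ℓ t ω j ∂μ ≤
      ∑ n ∈ Finset.range (N + 1),
        ∫ ω, H n (samplingDist η len (fun t => ℓ t ω) (fun k => I k ω) (n + 1)) ∂μ := by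
  refine (expected_regret_le hη hlen h0 hρ hℓ hI hN hT j g hgm hgb hg).trans
    (Finset.sum_le_sum fun n _ => ?_)
  have h1 : Integrable (fun ω =>
      ∑ i, samplingDist η len (fun t => ℓ t ω) (fun k => I k ω) (n + 1) i *
        g n i (samplingDist η len (fun t => ℓ t ω) (fun k => I k ω) (n + 1))) μ := by
    obtain ⟨ε, hε, h⟩ := exists_le_samplingDist (K := K) hη len n
    obtain ⟨M, hM⟩ := hgb n ε hε
    have hpm := (measurable_samplingDist_drawInfo hη len ℓ I n).mono (drawInfo_le hℓ hI _) le_rfl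
    refine integrable_finsetSum _ fun i _ => integrable_of_abs_le (M := M)
      (((measurable_pi_apply i).comp hpm).mul ((hgm n i).comp hpm)) fun ω => ?_
    rw [abs_mul, abs_of_nonneg (samplingDist_pos hη len _ _ n i).le]
    exact (mul_le_of_le_one_left (abs_nonneg _) (samplingDist_le_one _ _ _ _ _ _)).trans
      (hM i _ (samplingDist_mem _ _ _ _ _)
        (h (fun t => ℓ t ω) (fun k => I k ω) fun t ht i => hℓ.mem_Icc t ht ω i))
  have h2 := integrable_comp_samplingDist hη hℓ hI n
    (f := fun p => (ρ (n + 1) - ρ n) * (4 * (∑ i, √(p i) - 1))) (by fun_prop)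
  rw [← integral_add h1 h2]
  exact integral_mono (h1.add h2) (integrable_comp_samplingDist hη hℓ hI n (hH n)) fun ω =>
    hle n _ (samplingDist_mem _ _ _ _ _) (samplingDist_pos hη len _ _ n)

theorem pseudoRegret_playedArm_le [NeZero K] {lam B : ℝ} {T : ℕ}
    (h : ∀ j, (∫ ω, ∑ t ∈ Finset.Icc 1 T, ℓ t ω (I (blockIndex len t) ω) ∂μ)
        - ∫ ω, ∑ t ∈ Finset.Icc 1 T, ℓ t ω j ∂μ ≤ B) :
    pseudoRegret μ ℓ (playedArm len I) lam T ≤ B + lam * ∑ t ∈ Finset.Icc 1 T,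
      μ.real {ω | playedArm len I (t - 1) ω ≠ playedArm len I t ω} := by
  obtain ⟨j, hj⟩ := exists_eq_ciInf_of_finite (f := fun i =>
    ∫ ω, ∑ t ∈ Finset.Icc 1 T, ℓ t ω i ∂μ)
  have h1 : ∀ ω, ∑ t ∈ Finset.Icc 1 T, (playedArm len I t ω).elim 0 (ℓ t ω) =
      ∑ t ∈ Finset.Icc 1 T, ℓ t ω (I (blockIndex len t) ω) := fun ω =>
    Finset.sum_congr rfl fun t ht => by
      have := (Finset.mem_Icc.1 ht).1
      rw [playedArm, if_neg (by omega), Option.elim_some]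
  simp only [pseudoRegret, h1, ← hj]
  have := h j
  linarith

theorem exists_blocks {len : ℕ → ℕ} (hlen : ∀ n, 1 ≤ len n) {T : ℕ} (hT : 1 ≤ T) :
    ∃ N, blockEnd len N < T ∧ T ≤ blockEnd len (N + 1) := by
  obtain ⟨N, hN⟩ := Nat.exists_eq_add_of_le' (one_le_blockIndex hlen hT)
  have h := (blockIndex_eq_iff len hlen (by omega)).1 hN
  rw [block_succ, Finset.mem_Ioc] at h
  exact ⟨N, h⟩

theorem le_blockEnd {len : ℕ → ℕ} (hlen : ∀ n, 1 ≤ len n) (N : ℕ) : N ≤ blockEnd len N := by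
  simpa [blockEnd] using Finset.card_nsmul_le_sum (Finset.Icc 1 N) len 1 (fun m _ => hlen m)

/-! ### The adversarial regime -/

theorem sum_blockRate (lam : ℝ) (K N : ℕ) : ∑ n ∈ Finset.range N, blockRate lam K n =
    N * aCoeff lam K + ∑ n ∈ Finset.range N, 1 / √((n + 1 : ℕ) : ℝ) := by
  simp only [blockRate, Finset.sum_add_distrib, Finset.sum_const, Finset.card_range, nsmul_eq_mul]

theorem mul_div_sqrt_self {x : ℝ} (hx : 0 < x) (h : ℝ) : x * (h / √x) = h * √x := by
  rw [mul_div_assoc', div_eq_iff (Real.sqrt_pos.2 hx).ne', mul_assoc, Real.mul_self_sqrt hx.le,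
    mul_comm]

theorem pseudoRegret_le_adversarial [NeZero K] [IsProbabilityMeasure μ] {lam : ℝ} (hlam : 0 ≤ lam)
    (hℓ : IsLossProcess ℓ) (hI : IsTsallisSwitchRun μ (learningRate lam K) (blockLen lam K) ℓ I)
    {T : ℕ} (hT : 1 ≤ T) :
    pseudoRegret μ ℓ (playedArm (blockLen lam K) I) lam T ≤
      5.25 * ((lam * K) ^ (1 / 3 : ℝ) * (T : ℝ) ^ (2 / 3 : ℝ)) + 6.4 * √((K : ℝ) * T)
        + 5.25 * lam := by
  have hlen := one_le_blockLen lam K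
  have hη := learningRate_pos hlam K
  have hK := sqrt_natCast_pos (K := K)
  obtain ⟨N, hN, hN'⟩ := exists_blocks hlen hT
  set h : ℕ → ℝ := fun n => learningRate lam K (n + 1) / 2 * (blockLen lam K (n + 1) : ℝ) ^ 2
    with hh
  have hh0 : ∀ n, 0 ≤ h n := fun n => by have := hη n; positivity
  have hreg := fun j => expected_regret_le_of_continuous hη hlen (invRate_zero lam K)
    (invRate_succ hlam K) hℓ hI hN.le hN' j (fun n i p => h n / √(p i))
    (fun n i => measurable_const.div (measurable_pi_apply i).sqrt)
    (fun n ε hε => ⟨h n / √ε, fun i p _ hp => by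
      have h1 := Real.sqrt_pos.2 hε
      have h2 := Real.sqrt_le_sqrt (hp i)
      have h3 := hh0 n
      rw [abs_of_nonneg (by positivity)]
      gcongr⟩)
    (fun n C i c hc hcb => stepStability_le (hη n) C i hc hcb)
    (H := fun n _ => 2 * (√2 * blockRate lam K n * √(K : ℝ))) (fun n => continuous_const)
    (fun n p hp hpos => by
      have h1 := sum_sqrt_le hp
      have h2 := penalty_le hlam K n (x := ∑ i, √(p i) - 1) (s := √(K : ℝ)) (by linarith) hK.le
      have h3 : ∑ i, p i * (h n / √(p i)) ≤ √2 * blockRate lam K n * √(K : ℝ) := by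
        simp only [mul_div_sqrt_self (hpos _), ← Finset.mul_sum]
        have h4 := hh0 n
        exact mul_le_mul (half_learningRate_mul_sq_le hlam K n) h1
          (Finset.sum_nonneg fun i _ => Real.sqrt_nonneg _) (h4.trans
            (half_learningRate_mul_sq_le hlam K n))
      linarith)
  refine (pseudoRegret_playedArm_le hreg).trans ?_
  have hsw : ∑ t ∈ Finset.Icc 1 T, μ.real {ω | playedArm (blockLen lam K) I (t - 1) ω ≠
      playedArm (blockLen lam K) I t ω} ≤ N + 1 := by
    refine (sum_switch_le hlen hN').trans ?_
    refine (Finset.sum_le_card_nsmul _ _ 1 fun n _ => measureReal_le_one).trans_eq ?_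
    simp
  have h1 := mul_le_mul_of_nonneg_left hsw hlam
  have h2 : ∑ n ∈ Finset.range (N + 1), 2 * (√2 * blockRate lam K n * √(K : ℝ)) ≤
      2 * √2 * (3 * lam / 2 * (N + 1)) + 4 * √2 * √((K : ℝ) * T) := by
    have h3 : ∑ n ∈ Finset.range (N + 1), 2 * (√2 * blockRate lam K n * √(K : ℝ)) =
        2 * √2 * √(K : ℝ) * ∑ n ∈ Finset.range (N + 1), blockRate lam K n := by
      rw [Finset.mul_sum]
      exact Finset.sum_congr rfl fun n _ => by ring
    have h4 := sum_one_div_sqrt_le (N + 1)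
    have h5 : √((N + 1 : ℕ) : ℝ) ≤ √(T : ℝ) := by
      refine Real.sqrt_le_sqrt (Nat.cast_le.2 ?_)
      have := le_blockEnd hlen N
      omega
    -- The identity a √K = 3λ/2 makes the block-length part independent of K.
    rw [h3, sum_blockRate, Real.sqrt_mul (Nat.cast_nonneg _), ← aCoeff_mul_sqrt (K := K)]
    calc 2 * √2 * √(K : ℝ) * (((N + 1 : ℕ) : ℝ) * aCoeff lam K
          + ∑ n ∈ Finset.range (N + 1), 1 / √((n + 1 : ℕ) : ℝ))
        ≤ 2 * √2 * √(K : ℝ) * (((N + 1 : ℕ) : ℝ) * aCoeff lam K + 2 * √(T : ℝ)) := by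
          gcongr
          linarith
      _ = _ := by push_cast; ring
  simp only [integral_const, probReal_univ, one_smul]
  have h6 := lam_mul_blocks_le hlam hN.le
  -- The coefficient of λ(N + 1) is 3√2 from losses plus 1 from switches, below 5.25; that of √(KT)
  -- is 4√2, below 6.4.
  have h7 : √2 ≤ 1.4143 := Real.sqrt_le_iff.2 ⟨by norm_num, by norm_num⟩
  have h8 := Real.sqrt_nonneg ((K : ℝ) * T)
  have h9 : 0 ≤ lam * (N + 1) := by positivity
  have h10 := mul_le_mul_of_nonneg_right h7 h8
  have h11 := mul_le_mul_of_nonneg_right h7 h9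
  linarith

/-! ### The stochastically constrained regime -/

theorem integral_loss_sub_eq [IsProbabilityMeasure μ] (hℓ : IsLossProcess ℓ)
    {Δ : Fin K → Fin K → ℝ} (hΔ : IsStochasticallyConstrained μ ℓ Δ) {t : ℕ} (ht : 1 ≤ t)
    (i j : Fin K) : ∫ ω, (ℓ t ω i - ℓ t ω j) ∂μ = Δ i j := by
  have h := integral_pastLosses_mul_gap hℓ hΔ ht i j (X := fun _ => 1) measurable_const
    (M := 1) fun ω => by simp
  simp only [one_mul] at h
  rw [integral_sub _ (integrable_const _), integral_const, probReal_univ, one_smul,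
    sub_eq_zero] at h
  · exact h
  · refine integrable_of_abs_le (M := 1) ?_ fun ω => ?_
    · simpa using measurable_loss_sub hℓ ht i j 0
    · simpa using abs_loss_sub_le hℓ ht i j 0 ω

theorem integrable_loss [IsProbabilityMeasure μ] (hℓ : IsLossProcess ℓ) {t : ℕ} (ht : 1 ≤ t)
    (i : Fin K) : Integrable (fun ω => ℓ t ω i) μ :=
  integrable_of_abs_le ((measurable_pi_apply i).comp (hℓ.measurable t ht))
    fun ω => abs_le_one_of_mem_Icc (hℓ.mem_Icc t ht ω i)

/-- The Δ_{i,j} are differences of mean losses in round 1, so the reference arm cancels. -/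
theorem subGap_eq [NeZero K] [IsProbabilityMeasure μ] (hℓ : IsLossProcess ℓ)
    {Δ : Fin K → Fin K → ℝ} (hΔ : IsStochasticallyConstrained μ ℓ Δ) {istar : Fin K}
    (hs : IsUniqueBestArm Δ istar) (i : Fin K) : subGap Δ i = Δ i istar := by
  have h1 : Δ istar 0 = ⨅ j, Δ j 0 := sub_eq_zero.1 hs.1
  have h2 := fun i j => integral_loss_sub_eq hℓ hΔ le_rfl i j
  rw [subGap, ← h1, ← h2 i 0, ← h2 istar 0, ← h2 i istar]
  simp only [integral_sub (integrable_loss hℓ le_rfl _) (integrable_loss hℓ le_rfl _)]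
  ring

theorem subGap_le_one [NeZero K] [IsProbabilityMeasure μ] (hℓ : IsLossProcess ℓ)
    {Δ : Fin K → Fin K → ℝ} (hΔ : IsStochasticallyConstrained μ ℓ Δ) {istar : Fin K}
    (hs : IsUniqueBestArm Δ istar) (i : Fin K) : subGap Δ i ≤ 1 := by
  rw [subGap_eq hℓ hΔ hs, ← integral_loss_sub_eq hℓ hΔ le_rfl]
  have h : ∀ ω, ℓ 1 ω i - ℓ 1 ω istar ≤ 1 := fun ω => by
    linarith [(hℓ.mem_Icc 1 le_rfl ω i).2, (hℓ.mem_Icc 1 le_rfl ω istar).1]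
  refine (integral_mono ((integrable_loss hℓ le_rfl _).sub (integrable_loss hℓ le_rfl _))
    (integrable_const 1) h).trans ?_
  simp

theorem subGap_nonneg [NeZero K] {Δ : Fin K → Fin K → ℝ} {istar : Fin K}
    (hs : IsUniqueBestArm Δ istar) (i : Fin K) : 0 ≤ subGap Δ i := by
  rcases eq_or_ne i istar with rfl | h
  · exact hs.1.ge
  · exact (hs.2 i h).le

/-- The loss part of the regret is monotone in the horizon, and over whole blocks it is the sum of
the expected gaps. -/
theorem expected_regret_gap [NeZero K] [IsProbabilityMeasure μ]
    (hη : ∀ n, 0 < η (n + 1)) (hlen : ∀ n, 1 ≤ len n) (hℓ : IsLossProcess ℓ)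
    (hI : IsTsallisSwitchRun μ η len ℓ I) {Δ : Fin K → Fin K → ℝ} {istar : Fin K}
    (hΔ : IsStochasticallyConstrained μ ℓ Δ) (hs : IsUniqueBestArm Δ istar) {T N : ℕ}
    (hT : T ≤ blockEnd len N) :
    (∀ j, (∫ ω, ∑ t ∈ Finset.Icc 1 T, ℓ t ω (I (blockIndex len t) ω) ∂μ)
        - ∫ ω, ∑ t ∈ Finset.Icc 1 T, ℓ t ω j ∂μ ≤
      (∫ ω, ∑ t ∈ Finset.Icc 1 (blockEnd len N), ℓ t ω (I (blockIndex len t) ω) ∂μ)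
        - ∫ ω, ∑ t ∈ Finset.Icc 1 (blockEnd len N), ℓ t ω istar ∂μ) ∧
    (∫ ω, ∑ t ∈ Finset.Icc 1 (blockEnd len N), ℓ t ω (I (blockIndex len t) ω) ∂μ)
        - ∫ ω, ∑ t ∈ Finset.Icc 1 (blockEnd len N), ℓ t ω istar ∂μ =
      ∑ n ∈ Finset.range N, len (n + 1) * ∫ ω, ∑ i,
        samplingDist η len (fun t => ℓ t ω) (fun k => I k ω) (n + 1) i * subGap Δ i ∂μ := by
  set d : ℕ → ℝ := fun t => ∫ ω, (ℓ t ω (I (blockIndex len t) ω) - ℓ t ω istar) ∂μ with hd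
  set e : ℕ → ℝ := fun n => ∫ ω, ∑ i,
        samplingDist η len (fun t => ℓ t ω) (fun k => I k ω) (n + 1) i * subGap Δ i ∂μ with he
  have hlossI : ∀ t, 1 ≤ t → Integrable (fun ω => ℓ t ω (I (blockIndex len t) ω)) μ := fun t ht =>
    integrable_of_abs_le (measurable_apply_draw (f := fun i ω => ℓ t ω i)
      (hI.measurable _ (one_le_blockIndex hlen ht))
      fun i => (measurable_pi_apply i).comp (hℓ.measurable t ht))
      fun ω => abs_le_one_of_mem_Icc (hℓ.mem_Icc t ht ω _)
  have hdiff : ∀ T, (∫ ω, ∑ t ∈ Finset.Icc 1 T, ℓ t ω (I (blockIndex len t) ω) ∂μ)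
        - ∫ ω, ∑ t ∈ Finset.Icc 1 T, ℓ t ω istar ∂μ = ∑ t ∈ Finset.Icc 1 T, d t := fun T => by
    rw [integral_finsetSum _ fun t ht => hlossI t (Finset.mem_Icc.1 ht).1,
      integral_finsetSum _ fun t ht => integrable_loss hℓ (Finset.mem_Icc.1 ht).1 _,
      ← Finset.sum_sub_distrib]
    exact Finset.sum_congr rfl fun t ht => (integral_sub (hlossI t (Finset.mem_Icc.1 ht).1)
      (integrable_loss hℓ (Finset.mem_Icc.1 ht).1 _)).symm
  have hde : ∀ n, ∀ t ∈ block len (n + 1), d t = e n := fun n t ht => by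
    simp only [hd, he, blockIndex_of_mem_block hlen ht, subGap_eq hℓ hΔ hs]
    exact integral_loss_draw_sub hη hℓ hI hΔ istar ht
  have he0 : ∀ n, 0 ≤ e n := fun n => integral_nonneg fun ω => Finset.sum_nonneg fun i _ =>
    mul_nonneg (samplingDist_pos hη len _ _ n i).le (subGap_nonneg hs i)
  have hd0 : ∀ t, 1 ≤ t → 0 ≤ d t := fun t ht => by
    obtain ⟨n, hn⟩ := exists_blocks hlen ht
    rw [hde n t (Finset.mem_Ioc.2 hn)]
    exact he0 n
  rw [hdiff]
  refine ⟨fun j => ?_, ?_⟩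
  · have h1 : ∫ ω, ∑ t ∈ Finset.Icc 1 T, ℓ t ω istar ∂μ ≤
        ∫ ω, ∑ t ∈ Finset.Icc 1 T, ℓ t ω j ∂μ := by
      rw [integral_finsetSum _ fun t ht => integrable_loss hℓ (Finset.mem_Icc.1 ht).1 _,
        integral_finsetSum _ fun t ht => integrable_loss hℓ (Finset.mem_Icc.1 ht).1 _]
      refine Finset.sum_le_sum fun t ht => ?_
      have ht := (Finset.mem_Icc.1 ht).1
      have h2 := integral_loss_sub_eq hℓ hΔ ht j istar
      rw [integral_sub (integrable_loss hℓ ht _) (integrable_loss hℓ ht _),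
        ← subGap_eq hℓ hΔ hs] at h2
      linarith [subGap_nonneg hs j]
    have h2 := hdiff T
    have h3 : ∑ t ∈ Finset.Icc 1 T, d t ≤ ∑ t ∈ Finset.Icc 1 (blockEnd len N), d t :=
      Finset.sum_le_sum_of_subset_of_nonneg (Finset.Icc_subset_Icc_right hT)
        fun t ht _ => hd0 t (Finset.mem_Icc.1 ht).1
    linarith
  · rw [← sum_block]
    refine Finset.sum_congr rfl fun n _ => ?_
    rw [Finset.sum_congr rfl (hde n), Finset.sum_const, card_block_succ, nsmul_eq_mul]

end Regret

end

section

variable {K : ℕ} {Ω : Type*}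

/-! ### Self-bounding regret with a unique best arm -/

/-- The stability bound for a step against the best arm `s`, where `h` is half the learning rate
times the squared block length. In late blocks it is small when `s` is drawn while it is likely. -/
def gapStability (s : Fin K) (h : ℝ) (n : ℕ) (i : Fin K) (p : Fin K → ℝ) : ℝ :=
  if 99 ≤ n ∧ i = s then
    if 1 / 2 ≤ p s then 5 / 4 * h / p s * ∑ k ∈ Finset.univ.erase s, √(p k) else h / √(p i)
  else h / √(p i)

theorem measurable_gapStability (s : Fin K) (h : ℝ) (n : ℕ) (i : Fin K) :
    Measurable (gapStability s h n i) := by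
  have h1 : Measurable fun p : Fin K → ℝ => h / √(p i) :=
    measurable_const.div (measurable_pi_apply i).sqrt
  unfold gapStability
  split_ifs
  · refine Measurable.ite (measurableSet_le measurable_const (measurable_pi_apply s)) ?_ h1
    exact (measurable_const.div (measurable_pi_apply s)).mul
      (Finset.measurable_fun_sum _ fun k _ => (measurable_pi_apply k).sqrt)
  · exact h1

theorem exists_gapStability_le (s : Fin K) {h : ℝ} (hh : 0 ≤ h) (n : ℕ) {ε : ℝ} (hε : 0 < ε) :
    ∃ M : ℝ, ∀ i, ∀ p ∈ stdSimplex ℝ (Fin K), (∀ k, ε ≤ p k) → |gapStability s h n i p| ≤ M := by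
  refine ⟨h / √ε + 5 / 4 * h / ε * K, fun i p hp hpε => ?_⟩
  have hs := Real.sqrt_pos.2 hε
  have h1 : |h / √(p i)| ≤ h / √ε := by
    rw [abs_of_nonneg (by positivity)]
    have := Real.sqrt_le_sqrt (hpε i)
    gcongr
  have h2 : |5 / 4 * h / p s * ∑ k ∈ Finset.univ.erase s, √(p k)| ≤ 5 / 4 * h / ε * K := by
    have h3 : ∑ k ∈ Finset.univ.erase s, √(p k) ≤ K := by
      refine (Finset.sum_le_card_nsmul _ _ 1 fun k _ =>
        Real.sqrt_le_one.2 (mem_Icc_of_mem_stdSimplex hp k).2).trans ?_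
      rw [nsmul_eq_mul, mul_one, Nat.cast_le]
      exact (Finset.card_le_univ _).trans_eq (Fintype.card_fin K)
    have h4 := hε.trans_le (hpε s)
    have h5 : 0 ≤ ∑ k ∈ Finset.univ.erase s, √(p k) :=
      Finset.sum_nonneg fun k _ => Real.sqrt_nonneg _
    rw [abs_of_nonneg (by positivity)]
    have := hpε s
    gcongr
  have h6 : 0 ≤ h / √ε := by positivity
  have h7 : 0 ≤ 5 / 4 * h / ε * K := by positivity
  unfold gapStability
  split_ifs <;> linarith

theorem stepStability_le_gapStability [NeZero K] {lam : ℝ} (hlam : 0 ≤ lam) (s : Fin K) (n : ℕ)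
    (C : Fin K → ℝ) (i : Fin K) {c : ℝ} (hc : 0 ≤ c) (hcb : c ≤ (blockLen lam K (n + 1) : ℝ)) :
    stepStability (learningRate lam K (n + 1)) C i c ≤
      gapStability s (learningRate lam K (n + 1) / 2 * (blockLen lam K (n + 1) : ℝ) ^ 2) n i
        (tsallisArgmin (learningRate lam K (n + 1)) C) := by
  have h1 := stepStability_le (learningRate_pos hlam K n) C i hc hcb
  unfold gapStability
  split_ifs with h2 h3
  · obtain ⟨hn, rfl⟩ := h2
    refine stepStability_le_of_half_le (learningRate_pos hlam K n) C i hc hcb h3 ?_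
    have h4 := learningRate_mul_blockLen_le hlam K n
    -- Origin of the threshold 99: η · `len` ≤ 2√2/√(n+1) ≤ √2/5 is what
    -- `stepStability_le_of_half_le` needs.
    have h5 : 10 ≤ √((n + 1 : ℕ) : ℝ) := by
      refine Real.le_sqrt_of_sq_le ?_
      have : (99 : ℝ) ≤ n := by exact_mod_cast hn
      push_cast
      linarith
    have h6 : 2 * √2 / √((n + 1 : ℕ) : ℝ) ≤ 2 * √2 / 10 := by gcongr
    linarith
  · exact h1
  · exact h1

/-- Here p_s ≤ ∑_{k≠s} p_k ≤ (∑_{k≠s} √p_k)². This covers late blocks in which s is not yet likely.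
-/
theorem sqrt_le_sum_sqrt_of_le_half {p : Fin K → ℝ} (hp : p ∈ stdSimplex ℝ (Fin K)) (s : Fin K)
    (hs : p s ≤ 1 / 2) : √(p s) ≤ ∑ k ∈ Finset.univ.erase s, √(p k) := by
  have h0 : 0 ≤ ∑ k ∈ Finset.univ.erase s, √(p k) :=
    Finset.sum_nonneg fun k _ => Real.sqrt_nonneg _
  refine Real.sqrt_le_iff.2 ⟨h0, ?_⟩
  have h1 := Finset.add_sum_erase Finset.univ p (Finset.mem_univ s)
  rw [hp.2] at h1
  have h2 : ∑ k ∈ Finset.univ.erase s, p k ≤ (∑ k ∈ Finset.univ.erase s, √(p k)) ^ 2 := by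
    rw [sq, Finset.sum_mul]
    refine Finset.sum_le_sum fun k hk => ?_
    nth_rw 1 [← Real.mul_self_sqrt (hp.1 k)]
    exact mul_le_mul_of_nonneg_left (Finset.single_le_sum (f := fun k => √(p k))
      (fun k _ => Real.sqrt_nonneg _) hk) (Real.sqrt_nonneg _)
  linarith

/-- The factor 9/4 is 1 from the other arms plus 5/4 from s. Early blocks use √p_s ≤ 1 for s, which
costs the extra h. -/
theorem sum_mul_gapStability_le {p : Fin K → ℝ} (hp : p ∈ stdSimplex ℝ (Fin K))
    (hpos : ∀ k, 0 < p k) (s : Fin K) {h : ℝ} (hh : 0 ≤ h) (n : ℕ) :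
    ∑ i, p i * gapStability s h n i p ≤
      h * (9 / 4 * ∑ k ∈ Finset.univ.erase s, √(p k) + if n < 99 then 1 else 0) := by
  have h0 : 0 ≤ ∑ k ∈ Finset.univ.erase s, √(p k) :=
    Finset.sum_nonneg fun k _ => Real.sqrt_nonneg _
  have h1 : ∑ i ∈ Finset.univ.erase s, p i * gapStability s h n i p =
      h * ∑ k ∈ Finset.univ.erase s, √(p k) := by
    rw [Finset.mul_sum]
    refine Finset.sum_congr rfl fun i hi => ?_
    rw [gapStability, if_neg fun h => Finset.ne_of_mem_erase hi h.2, mul_div_sqrt_self (hpos i)]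
  rw [← Finset.add_sum_erase _ _ (Finset.mem_univ s), h1]
  have hle : √(p s) ≤ 1 := Real.sqrt_le_one.2 (mem_Icc_of_mem_stdSimplex hp s).2
  have h2 : p s * gapStability s h n s p ≤
      h * (5 / 4 * ∑ k ∈ Finset.univ.erase s, √(p k) + if n < 99 then 1 else 0) := by
    unfold gapStability
    by_cases hn : n < 99
    · rw [if_neg (by omega), if_pos hn, mul_div_sqrt_self (hpos s)]
      gcongr
      linarith
    · rw [if_pos ⟨by omega, rfl⟩, if_neg hn, add_zero]
      split_ifs with h3
      · refine le_of_eq ?_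
        have := (hpos s).ne'
        field_simp
      · rw [mul_div_sqrt_self (hpos s)]
        have := sqrt_le_sum_sqrt_of_le_half hp s (by linarith)
        gcongr
        linarith
  linarith

/-! ### Maximizing the quadratic of one arm in one block. -/

theorem two_mul_sub_le_div {y L δ x lam : ℝ} (hL : 0 < L) (hδ : 0 < δ) (hlam : 0 ≤ lam)
    (hx : 0 ≤ x) (hx1 : x ≤ 1) :
    2 * y * x - L * (δ * x ^ 2) + 2 * lam * x ^ 2 ≤
      (3 / 2 * (y ^ 2 / L) + 3 * (lam ^ 2 / L)) / δ := by
  -- The switching cost is made linear by x² ≤ x, so that it joins y before the square is completed.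
  have h1 : 2 * (y + lam) * x - L * δ * x ^ 2 ≤ (y + lam) ^ 2 / (L * δ) := by
    rw [le_div_iff₀ (by positivity)]
    nlinarith [sq_nonneg (L * δ * x - (y + lam))]
  have h2 : (y + lam) ^ 2 / (L * δ) ≤ (3 / 2 * y ^ 2 + 3 * lam ^ 2) / (L * δ) := by
    gcongr
    nlinarith [sq_nonneg (y - 2 * lam)]
  have h3 : (3 / 2 * (y ^ 2 / L) + 3 * (lam ^ 2 / L)) / δ =
      (3 / 2 * y ^ 2 + 3 * lam ^ 2) / (L * δ) := by
    field_simp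
  have h4 : lam * x ^ 2 ≤ lam * x := mul_le_mul_of_nonneg_left (by nlinarith) hlam
  rw [h3]
  nlinarith

/-- Variant for the block containing T: the switching cost is paid as 2λ ≤ 2λ/δ. The λ²/L version
would cost λ√K/√(N+1) there, while `lam_mul_sqrt_blocks_le` covers complete blocks only. -/
theorem two_mul_sub_le_div_of_le_one {y L δ x lam : ℝ} (hL : 0 < L) (hδ : 0 < δ) (hδ1 : δ ≤ 1)
    (hlam : 0 ≤ lam) (hx : 0 ≤ x) (hx1 : x ≤ 1) :
    2 * y * x - L * (δ * x ^ 2) + 2 * lam * x ^ 2 ≤ (3 / 2 * (y ^ 2 / L) + 2 * lam) / δ := by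
  have h1 : 2 * y * x - L * δ * x ^ 2 ≤ y ^ 2 / (L * δ) := by
    rw [le_div_iff₀ (by positivity)]
    nlinarith [sq_nonneg (L * δ * x - y)]
  have h2 : y ^ 2 / (L * δ) ≤ 3 / 2 * (y ^ 2 / L) / δ := by
    rw [← div_div]
    gcongr
    have : 0 ≤ y ^ 2 / L := by positivity
    linarith
  have h3 : 2 * lam * x ^ 2 ≤ 2 * lam / δ := by
    rw [le_div_iff₀ hδ]
    have : x ^ 2 * δ ≤ 1 := mul_le_one₀ (by nlinarith) hδ.le hδ1
    nlinarith
  rw [add_div]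
  linarith

/-- The bound on the loss part of the regret of a block. -/
def gapBound (lam : ℝ) (s : Fin K) (n : ℕ) (p : Fin K → ℝ) : ℝ :=
  √2 * blockRate lam K n *
    (13 / 4 * ∑ k ∈ Finset.univ.erase s, √(p k) + if n < 99 then 1 else 0)

/-- Twice the upper bound on the loss part of the regret of a block, minus that part itself, plus
the cost of switching away from and back to the best arm. -/
def selfBoundTerm (lam : ℝ) (s : Fin K) (δ : Fin K → ℝ) (n : ℕ) (p : Fin K → ℝ) : ℝ :=
  2 * gapBound lam s n p - blockLen lam K (n + 1) * ∑ i, p i * δ i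
    + 2 * lam * ∑ i ∈ Finset.univ.erase s, p i

/-- In the variables x_i = √p_i the expression splits into independent quadratics, one for each arm
other than s. -/
theorem selfBoundTerm_le {lam : ℝ} {s : Fin K} {δ : Fin K → ℝ} (hδs : δ s = 0) {n : ℕ}
    {p : Fin K → ℝ} (hp : p ∈ stdSimplex ℝ (Fin K)) {b : ℝ}
    (hb : ∀ i, i ≠ s → ∀ x, 0 ≤ x → x ≤ 1 →
      2 * (√2 * (13 / 4) * blockRate lam K n) * x - blockLen lam K (n + 1) * (δ i * x ^ 2)
        + 2 * lam * x ^ 2 ≤ b / δ i) :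
    selfBoundTerm lam s δ n p ≤ b * (∑ i ∈ Finset.univ.erase s, 1 / δ i)
      + 2 * √2 * (if n < 99 then blockRate lam K n else 0) := by
  have h1 : ∑ i, p i * δ i = ∑ i ∈ Finset.univ.erase s, p i * δ i := by
    rw [← Finset.add_sum_erase _ _ (Finset.mem_univ s), hδs, mul_zero, zero_add]
  have h2 : selfBoundTerm lam s δ n p = ∑ i ∈ Finset.univ.erase s,
      (2 * (√2 * (13 / 4) * blockRate lam K n) * √(p i)
        - blockLen lam K (n + 1) * (δ i * √(p i) ^ 2) + 2 * lam * √(p i) ^ 2)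
      + 2 * √2 * (if n < 99 then blockRate lam K n else 0) := by
    simp only [Real.sq_sqrt (hp.1 _), Finset.sum_add_distrib, Finset.sum_sub_distrib,
      ← Finset.mul_sum, selfBoundTerm, gapBound, h1]
    simp only [mul_comm (δ _)]
    split_ifs <;> ring
  rw [h2, Finset.mul_sum]
  refine add_le_add (Finset.sum_le_sum fun i hi => ?_) le_rfl
  rw [mul_one_div]
  exact hb i (Finset.ne_of_mem_erase hi) _ (Real.sqrt_nonneg _)
    (Real.sqrt_le_one.2 (mem_Icc_of_mem_stdSimplex hp i).2)

theorem sq_sqrt_two_mul_blockRate_div_le {lam : ℝ} (hlam : 0 ≤ lam) (K n : ℕ) :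
    3 / 2 * ((√2 * (13 / 4) * blockRate lam K n) ^ 2 / blockLen lam K (n + 1)) ≤
      32 * (1 / ((n + 1 : ℕ) : ℝ)) + 95.5 * aCoeff lam K * (1 / √((n + 1 : ℕ) : ℝ)) := by
  -- The factor 13/4 is 9/4 (stability) plus 1 (penalty), and (3/2) · 2 · (13/4)² = 31.6875 ≤ 32;
  -- three times this is at most 95.5.
  have h1 := sq_blockRate_div_le hlam K n
  have h2 := aCoeff_nonneg hlam K
  have h3 : 0 ≤ aCoeff lam K * (1 / √((n + 1 : ℕ) : ℝ)) := by positivity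
  have h4 : 0 ≤ 1 / ((n + 1 : ℕ) : ℝ) := by positivity
  rw [mul_pow, mul_pow, Real.sq_sqrt (by norm_num), mul_div_assoc]
  have h5 : 3 * aCoeff lam K / √((n + 1 : ℕ) : ℝ) =
    3 * (aCoeff lam K * (1 / √((n + 1 : ℕ) : ℝ))) := by ring
  rw [h5] at h1
  linarith

theorem selfBoundTerm_le_inner [NeZero K] {lam : ℝ} (hlam : 0 ≤ lam) {s : Fin K} {δ : Fin K → ℝ}
    (hδs : δ s = 0) (hδ : ∀ i, i ≠ s → 0 < δ i) (n : ℕ) {p : Fin K → ℝ}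
    (hp : p ∈ stdSimplex ℝ (Fin K)) :
    selfBoundTerm lam s δ n p ≤ (32 * (1 / ((n + 1 : ℕ) : ℝ))
      + 95.5 * aCoeff lam K * (1 / √((n + 1 : ℕ) : ℝ))
      + 2 * (lam * √(K : ℝ)) * (1 / √((n + 1 : ℕ) : ℝ))) * (∑ i ∈ Finset.univ.erase s, 1 / δ i)
      + 2 * √2 * (if n < 99 then blockRate lam K n else 0) := by
  refine selfBoundTerm_le hδs hp fun i hi x hx hx1 => ?_
  have hL : (0 : ℝ) < blockLen lam K (n + 1) := by exact_mod_cast one_le_blockLen lam K (n + 1)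
  refine (two_mul_sub_le_div hL (hδ i hi) hlam hx hx1).trans
    (div_le_div_of_nonneg_right ?_ (hδ i hi).le)
  rw [mul_one_div (2 * (lam * √(K : ℝ)))]
  exact add_le_add (sq_sqrt_two_mul_blockRate_div_le hlam K n) (sq_div_blockLen_le hlam n)

theorem selfBoundTerm_le_last {lam : ℝ} (hlam : 0 ≤ lam) {s : Fin K} {δ : Fin K → ℝ}
    (hδs : δ s = 0) (hδ : ∀ i, i ≠ s → 0 < δ i) (hδ1 : ∀ i, δ i ≤ 1) (n : ℕ) {p : Fin K → ℝ}
    (hp : p ∈ stdSimplex ℝ (Fin K)) :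
    selfBoundTerm lam s δ n p ≤ (32 * (1 / ((n + 1 : ℕ) : ℝ))
      + 95.5 * aCoeff lam K * (1 / √((n + 1 : ℕ) : ℝ)) + 2 * lam)
        * (∑ i ∈ Finset.univ.erase s, 1 / δ i)
      + 2 * √2 * (if n < 99 then blockRate lam K n else 0) := by
  refine selfBoundTerm_le hδs hp fun i hi x hx hx1 => ?_
  have hL : (0 : ℝ) < blockLen lam K (n + 1) := by exact_mod_cast one_le_blockLen lam K (n + 1)
  refine (two_mul_sub_le_div_of_le_one hL (hδ i hi) (hδ1 i) hlam hx hx1).trans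
    (div_le_div_of_nonneg_right ?_ (hδ i hi).le)
  exact add_le_add (sq_sqrt_two_mul_blockRate_div_le hlam K n) le_rfl

/-! ### Summation over the blocks. -/

theorem sum_early_blockRate_le {lam : ℝ} (hlam : 0 ≤ lam) (K N : ℕ) :
    2 * √2 * ∑ n ∈ Finset.range N, (if n < 99 then blockRate lam K n else 0) ≤
      544 * lam / √(K : ℝ) + 66 := by
  have h1 : ∑ n ∈ Finset.range N, (if n < 99 then blockRate lam K n else 0) ≤
      ∑ n ∈ Finset.range 99, blockRate lam K n := by
    rw [← Finset.sum_filter]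
    refine Finset.sum_le_sum_of_subset_of_nonneg (fun n hn => ?_)
      fun n _ _ => blockRate_nonneg hlam K n
    exact Finset.mem_range.2 (Finset.mem_filter.1 hn).2
  have h2 := sum_one_div_sqrt_le 99
  have h3 : √((99 : ℕ) : ℝ) ≤ 10 := Real.sqrt_le_iff.2 ⟨by norm_num, by norm_num⟩
  rw [sum_blockRate] at h1
  have h4 : √2 ≤ 1.42 := Real.sqrt_le_iff.2 ⟨by norm_num, by norm_num⟩
  have h5 : aCoeff lam K = 1.5 * (lam / √(K : ℝ)) := by
    rw [aCoeff]
    ring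
  have h6 : 0 ≤ lam / √(K : ℝ) := by positivity
  calc 2 * √2 * ∑ n ∈ Finset.range N, (if n < 99 then blockRate lam K n else 0)
      ≤ 2 * √2 * (148.5 * (lam / √(K : ℝ)) + 20) := by
        gcongr
        push_cast at h1 h2 h3
        linarith
    _ ≤ 2 * 1.42 * (148.5 * (lam / √(K : ℝ)) + 20) := by gcongr
    _ ≤ _ := by
        rw [mul_div_assoc]
        linarith

theorem sum_one_div_le_log {N T : ℕ} (h : N + 1 ≤ T) :
    ∑ n ∈ Finset.range (N + 1), 1 / ((n + 1 : ℕ) : ℝ) ≤ 1 + Real.log T := by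
  have h1 := harmonic_le_one_add_log (N + 1)
  have h2 : ((harmonic (N + 1) : ℚ) : ℝ) = ∑ n ∈ Finset.range (N + 1), 1 / ((n + 1 : ℕ) : ℝ) := by
    simp [harmonic]
  rw [h2] at h1
  have h3 : Real.log ((N + 1 : ℕ) : ℝ) ≤ Real.log T :=
    Real.log_le_log (by positivity) (by exact_mod_cast h)
  linarith

/-- Comparison of the coefficients of `∑ i, 1 / Δ i`. -/
theorem gap_coefficient_le [NeZero K] (hK2 : 2 ≤ K) {lam : ℝ} (hlam : 0 ≤ lam) {N T : ℕ}
    (hN : blockEnd (blockLen lam K) N ≤ T) (hNT : N + 1 ≤ T) :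
    32 * ∑ n ∈ Finset.range (N + 1), 1 / ((n + 1 : ℕ) : ℝ)
      + 95.5 * aCoeff lam K * ∑ n ∈ Finset.range (N + 1), 1 / √((n + 1 : ℕ) : ℝ)
      + 2 * (lam * √(K : ℝ)) * ∑ n ∈ Finset.range N, 1 / √((n + 1 : ℕ) : ℝ) + 2 * lam ≤
    66 * (lam * K) ^ (2 / 3 : ℝ) * (T : ℝ) ^ (1 / 3 : ℝ) + 32 * Real.log T
      + (160 * lam ^ (2 / 3 : ℝ) * (T : ℝ) ^ (1 / 3 : ℝ) * (K : ℝ) ^ (1 / 6 : ℝ)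
        + 160 * lam + 49 * lam ^ 2 + 32) := by
  have hK := sqrt_natCast_pos (K := K)
  have hKsq := Real.sq_sqrt (Nat.cast_nonneg (α := ℝ) K)
  have hK2' : (2 : ℝ) ≤ K := by exact_mod_cast hK2
  have h1 := sum_one_div_le_log hNT
  have h2 := sum_one_div_sqrt_le N
  have h3 : 1 / √((N + 1 : ℕ) : ℝ) ≤ 1 := by
    rw [div_le_one (sqrt_succ_pos N)]
    exact Real.one_le_sqrt.2 (by push_cast; linarith [Nat.cast_nonneg (α := ℝ) N])
  have h4 := lam_mul_sqrt_blocks_le hlam hN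
  set v := (lam * K) ^ (2 / 3 : ℝ) * (T : ℝ) ^ (1 / 3 : ℝ) with hv
  have hv0 : 0 ≤ v := by positivity
  have h5 : lam ^ (2 / 3 : ℝ) * (T : ℝ) ^ (1 / 3 : ℝ) * (K : ℝ) ^ (1 / 6 : ℝ) = v / √(K : ℝ) := by
    rw [eq_div_iff hK.ne', hv, Real.mul_rpow hlam (Nat.cast_nonneg _), Real.sqrt_eq_rpow, mul_assoc,
      ← Real.rpow_add (by linarith)]
    norm_num
    ring
  have h6 : aCoeff lam K = 1.5 * (lam / √(K : ℝ)) := by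
    rw [aCoeff]
    ring
  have hl : lam / √(K : ℝ) ≤ lam := div_le_self hlam (Real.one_le_sqrt.2 (by linarith))
  have hl0 : 0 ≤ lam / √(K : ℝ) := by positivity
  have h7 : lam / √(K : ℝ) * √(N : ℝ) ≤ v / K := by
    rw [le_div_iff₀ (by linarith)]
    calc lam / √(K : ℝ) * √(N : ℝ) * K = lam / √(K : ℝ) * √(N : ℝ) * √(K : ℝ) ^ 2 := by rw [hKsq]
      _ = lam * √(K : ℝ) * √(N : ℝ) := by field_simp
      _ ≤ v := h4
  -- Here K ≥ 2 matters: for K = 1 the inequality would read 287 ≤ 222. The remaining 4 of the 66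
  -- pays for `h10`.
  have h8 : 287 * (v / K) ≤ 62 * v + 160 * (v / √(K : ℝ)) := by
    set r := √(K : ℝ) with hr
    have h9 : 1.414 ≤ r := Real.le_sqrt_of_sq_le (by linarith)
    have h10 : 287 ≤ 62 * r ^ 2 + 160 * r := by nlinarith
    have h11 : 62 * v + 160 * (v / r) - 287 * (v / r ^ 2) =
        v / r ^ 2 * (62 * r ^ 2 + 160 * r - 287) := by field_simp
    rw [← hKsq]
    have h12 : 0 ≤ v / r ^ 2 * (62 * r ^ 2 + 160 * r - 287) :=
      mul_nonneg (by positivity) (by linarith)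
    linarith
  have h9 : 95.5 * aCoeff lam K * ∑ n ∈ Finset.range (N + 1), 1 / √((n + 1 : ℕ) : ℝ) ≤
      287 * (v / K) + 143.25 * lam := by
    rw [h6, Finset.sum_range_succ]
    calc 95.5 * (1.5 * (lam / √(K : ℝ))) *
          (∑ n ∈ Finset.range N, 1 / √((n + 1 : ℕ) : ℝ) + 1 / √((N + 1 : ℕ) : ℝ))
        ≤ 95.5 * (1.5 * (lam / √(K : ℝ))) * (2 * √(N : ℝ) + 1) := by gcongr
      _ = 286.5 * (lam / √(K : ℝ) * √(N : ℝ)) + 143.25 * (lam / √(K : ℝ)) := by ring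
      _ ≤ _ := by
        have : 0 ≤ v / K := by positivity
        linarith
  have h10 : 2 * (lam * √(K : ℝ)) * ∑ n ∈ Finset.range N, 1 / √((n + 1 : ℕ) : ℝ) ≤ 4 * v := by
    calc 2 * (lam * √(K : ℝ)) * ∑ n ∈ Finset.range N, 1 / √((n + 1 : ℕ) : ℝ)
        ≤ 2 * (lam * √(K : ℝ)) * (2 * √(N : ℝ)) := by gcongr
      _ = 4 * (lam * √(K : ℝ) * √(N : ℝ)) := by ring
      _ ≤ _ := by linarith
  have h11 : 0 ≤ lam ^ 2 := by positivity
  have h12 : 66 * (lam * K) ^ (2 / 3 : ℝ) * (T : ℝ) ^ (1 / 3 : ℝ) = 66 * v := by rw [hv]; ring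
  have h13 : 160 * lam ^ (2 / 3 : ℝ) * (T : ℝ) ^ (1 / 3 : ℝ) * (K : ℝ) ^ (1 / 6 : ℝ) =
      160 * (v / √(K : ℝ)) := by rw [← h5]; ring
  rw [h12, h13]
  linarith

/-! ### Assembly of the stochastic bound. -/

variable [MeasurableSpace Ω] {μ : Measure Ω} {ℓ : ℕ → Ω → Fin K → ℝ} {I : ℕ → Ω → Fin K}

theorem continuous_gapBound (lam : ℝ) (s : Fin K) (n : ℕ) : Continuous (gapBound lam s n) := by
  unfold gapBound
  fun_prop

theorem expected_regret_le_gapBound [NeZero K] [IsProbabilityMeasure μ] {lam : ℝ}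
    (hlam : 0 ≤ lam) (hℓ : IsLossProcess ℓ)
    (hI : IsTsallisSwitchRun μ (learningRate lam K) (blockLen lam K) ℓ I) (s : Fin K) (N : ℕ) :
    (∫ ω, ∑ t ∈ Finset.Icc 1 (blockEnd (blockLen lam K) (N + 1)),
        ℓ t ω (I (blockIndex (blockLen lam K) t) ω) ∂μ)
        - ∫ ω, ∑ t ∈ Finset.Icc 1 (blockEnd (blockLen lam K) (N + 1)), ℓ t ω s ∂μ ≤
      ∑ n ∈ Finset.range (N + 1), ∫ ω, gapBound lam s n (samplingDist (learningRate lam K)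
        (blockLen lam K) (fun t => ℓ t ω) (fun k => I k ω) (n + 1)) ∂μ := by
  set h : ℕ → ℝ := fun n => learningRate lam K (n + 1) / 2 * (blockLen lam K (n + 1) : ℝ) ^ 2
    with hh
  have hh0 : ∀ n, 0 ≤ h n := fun n => by have := learningRate_pos hlam K n; positivity
  refine expected_regret_le_of_continuous (learningRate_pos hlam K) (one_le_blockLen lam K)
    (invRate_zero lam K) (invRate_succ hlam K) hℓ hI (blockEnd_mono _ N.le_succ) le_rfl s
    (fun n => gapStability s (h n) n) (fun n i => measurable_gapStability s (h n) n i)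
    (fun n ε hε => exists_gapStability_le s (hh0 n) n hε)
    (fun n C i c hc hcb => stepStability_le_gapStability hlam s n C i hc hcb)
    (continuous_gapBound lam s) fun n p hp hpos => ?_
  have hle : √(p s) ≤ 1 := Real.sqrt_le_one.2 (mem_Icc_of_mem_stdSimplex hp s).2
  have h0 : 0 ≤ ∑ k ∈ Finset.univ.erase s, √(p k) :=
    Finset.sum_nonneg fun k _ => Real.sqrt_nonneg _
  have h1 := sum_mul_gapStability_le hp hpos s (hh0 n) n
  have h2 : h n * (9 / 4 * ∑ k ∈ Finset.univ.erase s, √(p k) + if n < 99 then 1 else 0) ≤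
      √2 * blockRate lam K n *
        (9 / 4 * ∑ k ∈ Finset.univ.erase s, √(p k) + if n < 99 then 1 else 0) := by
    refine mul_le_mul_of_nonneg_right (half_learningRate_mul_sq_le hlam K n) ?_
    split_ifs <;> positivity
  have h3 := penalty_le hlam K n (x := ∑ i, √(p i) - 1)
    (by rw [← Finset.add_sum_erase _ _ (Finset.mem_univ s)]; linarith) h0
  unfold gapBound
  linarith

/-- Self-bounding: with X the loss regret over whole blocks and Y ≥ X its FTRL bound, X ≤ 2Y - X,
and the negative X pays for both the √p_i terms and the switches. -/
theorem pseudoRegret_le_stochastic [NeZero K] [IsProbabilityMeasure μ] {lam : ℝ} (hlam : 0 ≤ lam)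
    (hℓ : IsLossProcess ℓ) (hI : IsTsallisSwitchRun μ (learningRate lam K) (blockLen lam K) ℓ I)
    {T : ℕ} (hT : 1 ≤ T) {Δ : Fin K → Fin K → ℝ} {istar : Fin K}
    (hΔ : IsStochasticallyConstrained μ ℓ Δ) (hs : IsUniqueBestArm Δ istar) :
    pseudoRegret μ ℓ (playedArm (blockLen lam K) I) lam T ≤
      (66 * (lam * K) ^ (2 / 3 : ℝ) * (T : ℝ) ^ (1 / 3 : ℝ) + 32 * Real.log T
        + (160 * lam ^ (2 / 3 : ℝ) * (T : ℝ) ^ (1 / 3 : ℝ) * (K : ℝ) ^ (1 / 6 : ℝ)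
        + 160 * lam + 49 * lam ^ 2 + 32)) * ∑ i ∈ Finset.univ.erase istar, 1 / subGap Δ i
        + (544 * lam / √(K : ℝ) + 66) + lam := by
  have hlen := one_le_blockLen lam K
  have hη := learningRate_pos hlam K
  obtain ⟨N, hN, hN'⟩ := exists_blocks hlen hT
  have hNT : N + 1 ≤ T := by
    have := le_blockEnd hlen N
    omega
  -- The horizon is extended to the end of its block: expected per-round regrets against the best
  -- arm are nonnegative, and X becomes exact.
  obtain ⟨hX1, hX2⟩ := expected_regret_gap hη hlen hℓ hI hΔ hs hN'
  have hY := expected_regret_le_gapBound hlam hℓ hI istar N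
  have hW := mul_le_mul_of_nonneg_left (sum_switch_le_suboptimal hη hlen hℓ hI hN' istar) hlam
  have hR := pseudoRegret_playedArm_le (lam := lam) hX1
  set p : ℕ → Ω → Fin K → ℝ := fun n ω => samplingDist (learningRate lam K) (blockLen lam K)
    (fun t => ℓ t ω) (fun k => I k ω) (n + 1) with hp
  have hterm : ∀ n, 2 * ∫ ω, gapBound lam istar n (p n ω) ∂μ
      - blockLen lam K (n + 1) * ∫ ω, ∑ i, p n ω i * subGap Δ i ∂μ
      + 2 * lam * ∫ ω, ∑ i ∈ Finset.univ.erase istar, p n ω i ∂μ =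
      ∫ ω, selfBoundTerm lam istar (subGap Δ) n (p n ω) ∂μ := fun n => by
    have i1 := (integrable_comp_samplingDist hη hℓ hI n
      (continuous_gapBound lam istar n)).const_mul 2
    have i2 := (integrable_comp_samplingDist hη hℓ hI n
      (f := fun p => ∑ i, p i * subGap Δ i) (by fun_prop)).const_mul
        (blockLen lam K (n + 1) : ℝ)
    have i3 := (integrable_comp_samplingDist hη hℓ hI n
      (f := fun p => ∑ i ∈ Finset.univ.erase istar, p i) (by fun_prop)).const_mul (2 * lam)
    rw [← integral_const_mul, ← integral_const_mul, ← integral_const_mul]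
    exact ((integral_add (i1.sub i2) i3).trans (congrArg (· + _) (integral_sub i1 i2))).symm
  have hsI : ∀ n, Integrable (fun ω => selfBoundTerm lam istar (subGap Δ) n (p n ω)) μ := fun n =>
    integrable_comp_samplingDist hη hℓ hI n (by
      have := continuous_gapBound (K := K) lam istar n
      unfold selfBoundTerm
      fun_prop)
  have hsum : pseudoRegret μ ℓ (playedArm (blockLen lam K) I) lam T ≤
      ∑ n ∈ Finset.range (N + 1), ∫ ω, selfBoundTerm lam istar (subGap Δ) n (p n ω) ∂μ + lam := by
    simp only [← hterm, Finset.sum_add_distrib, Finset.sum_sub_distrib, ← Finset.mul_sum]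
    linarith
  have hconst : ∀ n (b : ℝ), (∀ ω, selfBoundTerm lam istar (subGap Δ) n (p n ω) ≤ b) →
      ∫ ω, selfBoundTerm lam istar (subGap Δ) n (p n ω) ∂μ ≤ b := fun n b hb => by
    refine (integral_mono (hsI n) (integrable_const b) hb).trans_eq ?_
    simp
  set S := ∑ i ∈ Finset.univ.erase istar, 1 / subGap Δ i with hS
  have hS0 : 0 ≤ S := Finset.sum_nonneg fun i _ => one_div_nonneg.2 (subGap_nonneg hs i)
  have h1 : ∑ n ∈ Finset.range N, ∫ ω, selfBoundTerm lam istar (subGap Δ) n (p n ω) ∂μ ≤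
      ∑ n ∈ Finset.range N, ((32 * (1 / ((n + 1 : ℕ) : ℝ))
        + 95.5 * aCoeff lam K * (1 / √((n + 1 : ℕ) : ℝ))
        + 2 * (lam * √(K : ℝ)) * (1 / √((n + 1 : ℕ) : ℝ))) * S
        + 2 * √2 * (if n < 99 then blockRate lam K n else 0)) :=
    Finset.sum_le_sum fun n _ => hconst n _ fun ω =>
      selfBoundTerm_le_inner hlam hs.1 hs.2 n (samplingDist_mem _ _ _ _ _)
  have h2 := hconst N _ fun ω => selfBoundTerm_le_last hlam hs.1 hs.2 (subGap_le_one hℓ hΔ hs) N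
    (samplingDist_mem (learningRate lam K) (blockLen lam K) (fun t => ℓ t ω) (fun k => I k ω)
      (N + 1))
  have h3 := sum_early_blockRate_le hlam K (N + 1)
  have h4 : (32 * ∑ n ∈ Finset.range (N + 1), 1 / ((n + 1 : ℕ) : ℝ)
      + 95.5 * aCoeff lam K * ∑ n ∈ Finset.range (N + 1), 1 / √((n + 1 : ℕ) : ℝ)
      + 2 * (lam * √(K : ℝ)) * ∑ n ∈ Finset.range N, 1 / √((n + 1 : ℕ) : ℝ) + 2 * lam) * S ≤
      (66 * (lam * K) ^ (2 / 3 : ℝ) * (T : ℝ) ^ (1 / 3 : ℝ) + 32 * Real.log T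
        + (160 * lam ^ (2 / 3 : ℝ) * (T : ℝ) ^ (1 / 3 : ℝ) * (K : ℝ) ^ (1 / 6 : ℝ)
        + 160 * lam + 49 * lam ^ 2 + 32)) * S := by
    -- With a single arm the sum over suboptimal arms is empty, so the coefficients need no
    -- comparison.
    rcases Nat.lt_or_ge K 2 with hK | hK
    · have hcard : (Finset.univ.erase istar).card = 0 := by
        rw [Finset.card_erase_of_mem (Finset.mem_univ _), Finset.card_univ, Fintype.card_fin]
        omega
      have : S = 0 := by rw [hS, Finset.card_eq_zero.1 hcard, Finset.sum_empty]
      rw [this, mul_zero, mul_zero]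
    · exact mul_le_mul_of_nonneg_right (gap_coefficient_le hK hlam hN.le hNT) hS0
  rw [Finset.sum_range_succ] at hsum
  simp only [Finset.sum_add_distrib, ← Finset.mul_sum, ← Finset.sum_mul] at h1
  rw [Finset.sum_range_succ] at h3
  rw [Finset.sum_range_succ, Finset.sum_range_succ _ N] at h4
  linarith

end

end TsallisSwitch

end

theorem theorem1 {K : ℕ} [NeZero K] (lam : ℝ) (hlam : 0 ≤ lam)
    {Ω : Type*} [MeasurableSpace Ω] (μ : MeasureTheory.Measure Ω)
    [MeasureTheory.IsProbabilityMeasure μ]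
    (ℓ : ℕ → Ω → Fin K → ℝ) (hℓ : TsallisSwitch.IsLossProcess ℓ)
    (I : ℕ → Ω → Fin K)
    (hI : TsallisSwitch.IsTsallisSwitchRun μ (TsallisSwitch.learningRate lam K)
      (TsallisSwitch.blockLen lam K) ℓ I)
    (T : ℕ) (hT : 1 ≤ T) :
    TsallisSwitch.pseudoRegret μ ℓ
        (TsallisSwitch.playedArm (TsallisSwitch.blockLen lam K) I) lam T
      ≤ 5.25 * (lam * K) ^ (1 / 3 : ℝ) * (T : ℝ) ^ (2 / 3 : ℝ) + 6.4 * √((K : ℝ) * T)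
        + 3 * √(2 * (K : ℝ)) + 5.25 * lam + 6.25
    ∧ ∀ (Δ : Fin K → Fin K → ℝ) (istar : Fin K),
        TsallisSwitch.IsStochasticallyConstrained μ ℓ Δ →
        TsallisSwitch.IsUniqueBestArm Δ istar →
        TsallisSwitch.pseudoRegret μ ℓ
            (TsallisSwitch.playedArm (TsallisSwitch.blockLen lam K) I) lam T
          ≤ (66 * (lam * K) ^ (2 / 3 : ℝ) * (T : ℝ) ^ (1 / 3 : ℝ) + 32 * Real.log T)
              * ∑ i ∈ Finset.univ.erase istar, 1 / TsallisSwitch.subGap Δ i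
            + (160 * lam ^ (2 / 3 : ℝ) * (T : ℝ) ^ (1 / 3 : ℝ) * (K : ℝ) ^ (1 / 6 : ℝ)
                + 160 * lam + 49 * lam ^ 2 + 32)
              * ∑ i ∈ Finset.univ.erase istar, 1 / TsallisSwitch.subGap Δ i
            + 544 * lam / √(K : ℝ) + lam + 66 := by
  refine ⟨?_, fun Δ istar hΔ hs => ?_⟩
  -- The bound already holds without 3√(2K) and 6.25, which are nonnegative slack.
  · have h := TsallisSwitch.pseudoRegret_le_adversarial hlam hℓ hI hT
    have hK := Real.sqrt_nonneg (2 * (K : ℝ))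
    linarith
  · have h := TsallisSwitch.pseudoRegret_le_stochastic hlam hℓ hI hT hΔ hs
    linarith
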